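/- A graphon $W=(W,S,\mu)$ is a symmetric integrable function $W\colon S\times S\to\mathbb R$, where $(S,\mu)$ is any $\sigma$-finite measure space (part of the data of $W$; different graphons may live on different spaces); graphons on the same space that are equal a.e. are identified. Write $\|W\|_p$ for the norm of $W$ in $L^p(S^2,\mu^2)$. The cut norm of $F\in L^1(S^2,\mu^2)$ is $\|F\|_{\square,\mu}=\sup_{T,U}\bigl|\int_{T\times U}F\,d\mu^2\bigr|$, over measurable $T,U\subseteq S$. A trivial extension of $(W,S,\mu)$ is a graphon $(\widetilde W,\widetilde S,\widetilde\mu)$ such that $S$ is a measurable subset of $\widetilde S$, $\mu$ is the restriction of $\widetilde\mu$ to $S$, $\widetilde W=W$ on $S\times S$, and $\widetilde W=0$ elsewhere. The cut metric is the pseudometric $\delta_\square$ defined as follows. If $\mu_1(S_1)=\mu_2(S_2)$, then $\delta_\square(W_1,W_2)=\inf_\gamma\|W_1(x_1,y_1)-W_2(x_2,y_2)\|_{\square,\gamma}$, where the infimum is over all measures $\gamma$ on $S_1\times S_2$ with marginals $\mu_1,\mu_2$, and $W_1(x_1,y_1)-W_2(x_2,y_2)$ is regarded as a function of $((x_1,x_2),(y_1,y_2))\in(S_1\times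 S_2)^2$. In general, $\delta_\square(W_1,W_2)=\delta_\square(\widetilde W_1,\widetilde W_2)$ for any trivial extensions $\widetilde W_1,\widetilde W_2$ of $W_1,W_2$ to spaces of equal total mass; the value does not depend on the choice of these extensions. A set $\mathcal A$ of graphons is relatively complete for the cut metric if every sequence in $\mathcal A$ that is Cauchy for $\delta_\square$ converges in $\delta_\square$ to some graphon, and complete if every such sequence converges to some element of $\mathcal A$. The set $\mathcal A$ is semiuniformly integrable if $\sup_{W\in\mathcal A}\int_{|W|>B}|W|\,d\mu^2\to0$ as $B\to\infty$, and uniformly integrable if, in addition, $\sup_{W\in\mathcal A}\int|W|\,d\mu^2<\infty$. Theorem 6.6. (i) Any uniformly integrable set of graphons is relatively complete for the cut metric. (ii) Any semiuniformly integrable set of non-negative graphons is relatively complete for the cut metric. (iii) If $1<p\le\infty$ and $0\le C<\infty$, then the set of non-negative graphons $W$ with $\|W\|_p\le C$ is complete for the cut metric. Hence, any set of non-negative graphons that is bounded in $L^p$ is relatively complete for the cut metric. (iv) The set of $[0,1]$-valued graphons is complete for the cut metric. (v) If $1<p\le\infty$ and $0\le C,C_1<\infty$, then the set of graphons $W$ with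 $\|W\|_p\le C$ and $\|W\|_1\le C_1$ is complete for the cut metric. Hence, any set of graphons that is bounded in both $L^1$ and $L^p$ is relatively complete for the cut metric. -/

import Mathlib

open MeasureTheory Filter Topology Set
open scoped ENNReal NNReal

universe u

/-- A graphon: a symmetric integrable real function `W` on `S × S`, where `(S, μ)` is an arbitrary
σ-finite measure space; the space is part of the data. -/
structure Graphon where
  /-- the underlying space -/
  S : Type u
  /-- its σ-algebra -/
  [mS : MeasurableSpace S]
  /-- its measure -/
  μ : Measure S
  [sigmaFinite : SigmaFinite μ]
  /-- the function -/
  W : S × S → ℝ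
  measurable : Measurable W
  symm : ∀ x y, W (x, y) = W (y, x)
  integrable : Integrable W (μ.prod μ)

attribute [instance] Graphon.mS Graphon.sigmaFinite

/-- The cut norm of `F` on `(S × S, μ × μ)`: the supremum of `|∫_{T × U} F|` over all measurable
`T, U ⊆ S`. -/
noncomputable def cutNorm {S : Type*} [MeasurableSpace S] (μ : Measure S) (F : S × S → ℝ) :
    ℝ≥0∞ :=
  ⨆ (T : Set S) (_ : MeasurableSet T) (U : Set S) (_ : MeasurableSet U),
    ‖∫ z in T ×ˢ U, F z ∂(μ.prod μ)‖ₑ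

/-- `γ` is a coupling measure of `μ₁` and `μ₂`: its two marginals are `μ₁` and `μ₂`. -/
structure IsCouplingMeasure {S₁ S₂ : Type*} [MeasurableSpace S₁] [MeasurableSpace S₂]
    (γ : Measure (S₁ × S₂)) (μ₁ : Measure S₁) (μ₂ : Measure S₂) : Prop where
  map_fst : γ.map Prod.fst = μ₁
  map_snd : γ.map Prod.snd = μ₂

namespace Graphon

/-- `V` is a trivial extension of `W`: the measure space of `W` is (through `ι`) a measurable
subset of that of `V` with the restricted measure, `V` agrees with `W` there, and `V (x, y) = 0`
unless both `x` and `y` lie in that subset. -/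
def IsTrivialExtension (V W : Graphon.{u}) : Prop :=
  ∃ ι : W.S → V.S, MeasurableEmbedding ι ∧
    V.μ.restrict (range ι) = W.μ.map ι ∧
    (∀ x y, V.W (ι x, ι y) = W.W (x, y)) ∧
    ∀ x y, (x ∉ range ι ∨ y ∉ range ι) → V.W (x, y) = 0

/-- The infimum of `‖W₁^{π₁} - W₂^{π₂}‖_□` over all couplings of the two underlying measure spaces.
It is the cut distance of two graphons of equal total mass (and is `∞` if the total masses differ,
when no coupling exists). -/
noncomputable def couplingDist (W₁ W₂ : Graphon.{u}) : ℝ≥0∞ :=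
  ⨅ (γ : Measure (W₁.S × W₂.S)) (_ : IsCouplingMeasure γ W₁.μ W₂.μ),
    cutNorm γ (fun z => W₁.W (z.1.1, z.2.1) - W₂.W (z.1.2, z.2.2))

/-- The cut metric: the coupling distance of trivial extensions of `W₁` and `W₂` to spaces of equal
total mass. The value is the same for all such pairs of extensions (which include `W₁` and `W₂`
themselves when their total masses are equal), so no choice is made here and the infimum is
taken. -/
noncomputable def cutDist (W₁ W₂ : Graphon.{u}) : ℝ≥0∞ :=
  ⨅ (V₁ : Graphon.{u}) (V₂ : Graphon.{u}) (_ : IsTrivialExtension V₁ W₁)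
    (_ : IsTrivialExtension V₂ W₂) (_ : V₁.μ univ = V₂.μ univ), couplingDist V₁ V₂

/-- Cauchy sequences for the cut metric. -/
def IsCutCauchy (W : ℕ → Graphon.{u}) : Prop :=
  ∀ ε : ℝ≥0∞, 0 < ε → ∃ N : ℕ, ∀ m ≥ N, ∀ n ≥ N, cutDist (W m) (W n) < ε

/-- Convergence for the cut metric. -/
def CutConverges (W : ℕ → Graphon.{u}) (V : Graphon.{u}) : Prop :=
  Tendsto (fun n => cutDist (W n) V) atTop (𝓝 0)

/-- Every Cauchy sequence in `A` converges to some graphon, not necessarily in `A`. -/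
def IsRelativelyCutComplete (A : Set Graphon.{u}) : Prop :=
  ∀ W : ℕ → Graphon.{u}, (∀ n, W n ∈ A) → IsCutCauchy W → ∃ V, CutConverges W V

/-- Every Cauchy sequence in `A` converges to an element of `A`; equivalently, the set of
equivalence classes (at cut distance `0`) of elements of `A` is a complete metric space. -/
def IsCutComplete (A : Set Graphon.{u}) : Prop :=
  ∀ W : ℕ → Graphon.{u}, (∀ n, W n ∈ A) → IsCutCauchy W → ∃ V ∈ A, CutConverges W V

/-- `W ≥ 0` (graphons are identified when they are equal a.e.). -/
def IsNonneg (W : Graphon.{u}) : Prop :=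
  ∀ᵐ z ∂(W.μ.prod W.μ), 0 ≤ W.W z

/-- `W` takes values in `[0,1]` (graphons are identified when they are equal a.e.). -/
def IsUnitValued (W : Graphon.{u}) : Prop :=
  ∀ᵐ z ∂(W.μ.prod W.μ), W.W z ∈ Icc (0 : ℝ) 1

/-- The `L^p` norm of a graphon, possibly infinite. -/
noncomputable def lpNorm (p : ℝ≥0∞) (W : Graphon.{u}) : ℝ≥0∞ :=
  eLpNorm W.W p (W.μ.prod W.μ)

/-- Semiuniform integrability: `sup_{W ∈ A} ∫_{|W| > B} |W| → 0` as `B → ∞`. -/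
def IsSemiUI (A : Set Graphon.{u}) : Prop :=
  Tendsto (fun B : ℝ => ⨆ W ∈ A, ∫⁻ z in {z | B < |W.W z|}, ‖W.W z‖ₑ ∂(W.μ.prod W.μ))
    atTop (𝓝 0)

/-- Uniform integrability: `sup_{W ∈ A} ∫ |W| < ∞`, and semiuniform integrability. -/
def IsUI (A : Set Graphon.{u}) : Prop :=
  (⨆ W ∈ A, ∫⁻ z, ‖W.W z‖ₑ ∂(W.μ.prod W.μ)) < ∞ ∧ IsSemiUI A

end Graphon

/-! The heart is a compactness argument on one fixed σ-finite space. Let kernels `f n` be Cauchy in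
the cut norm, semiuniformly integrable and eventually bounded in `L¹`. Pass to an equivalent finite
measure, where suitable convex combinations of the tails converge in `L¹` to some `g`. The condition
that a given cut integral of `f n - u` be at most `ε` is convex in `u` and holds for every `u = f l`
with `l` large, hence for the combinations, hence for `g`. So the whole sequence converges to `g` in
the cut norm, although only averages converge strongly. The same convexity, with Fatou, carries
`L^p` bounds and signs to the limit (`exists_cutNorm_limit`).

To reach one space, code every graphon as the pullback of a function on the Cantor space `X` that
vanishes at a base point `o`. A trivial extension sends its new points to `o`, so couplings of
extensions become measures on `X × X` whose marginals matter only off `o`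
(`exists_pointed_coupling`). Choose checkpoints `N k` beyond which all cut distances are below `2⁻¹
^ k`, and couple each index `m + 1` to the last checkpoint not after `m`. These couplings form a
tree, so they are realised jointly by one measure on `ℕ → X` (`exists_glued_measure`); there the
entire sequence is Cauchy in the cut norm, by a geometric sum. Neither a subsequence nor the
triangle inequality for `cutDist` is needed.

Conversely, cut norms on the common space bound `cutDist` from above (`IsRepresentedBy.cutDist_le`),
since pulling back does not increase the cut norm. For nonnegative graphons the `L¹` bound is free,
because total integrals are themselves cut integrals. An `L^p` bound with `p > 1` gives semiuniform
integrability, and `[0,1]`-valued graphons are the case `p = ∞`, `C = 1`. -/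

/-! ### Convex combinations of tails in a Hilbert space -/

/-- The finitely supported convex weights on `ℕ` that vanish below `k`. -/
def tailSimplex (k : ℕ) : Set (ℕ →₀ ℝ) :=
  {w | (∀ n, 0 ≤ w n) ∧ ∑ n ∈ w.support, w n = 1 ∧ ∀ n < k, w n = 0}

theorem tailSimplex_anti {k l : ℕ} (h : k ≤ l) : tailSimplex l ⊆ tailSimplex k :=
  fun _ hw => ⟨hw.1, hw.2.1, fun n hn => hw.2.2 n (hn.trans_le h)⟩

theorem single_mem_tailSimplex (k : ℕ) : Finsupp.single k (1 : ℝ) ∈ tailSimplex k := by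
  refine ⟨fun n => ?_, ?_, fun n hn => ?_⟩
  · by_cases h : k = n <;> simp [h]
  · rw [Finsupp.support_single _ one_ne_zero]; simp
  · simp [hn.ne']

theorem linearCombination_mem_of_convex {E : Type*} [AddCommGroup E] [Module ℝ E] {C : Set E}
    (hC : Convex ℝ C) {x : ℕ → E} {k : ℕ} (hx : ∀ n ≥ k, x n ∈ C) {w : ℕ →₀ ℝ}
    (hw : w ∈ tailSimplex k) : Finsupp.linearCombination ℝ x w ∈ C := by
  rw [Finsupp.linearCombination_apply, Finsupp.sum]
  refine hC.sum_mem (fun i _ => hw.1 i) hw.2.1 fun i hi => hx i ?_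
  by_contra! h
  exact Finsupp.mem_support_iff.1 hi (hw.2.2 i h)

theorem tailSimplex_eq (k : ℕ) : tailSimplex k = {w | (∀ n, 0 ≤ w n) ∧
    Finsupp.linearCombination ℝ (fun _ => (1 : ℝ)) w = 1 ∧ ∀ n < k, w n = 0} := by
  ext w; simp [tailSimplex, Finsupp.linearCombination_apply, Finsupp.sum]

theorem convex_tailSimplex (k : ℕ) : Convex ℝ (tailSimplex k) := by
  rw [tailSimplex_eq]
  rintro v ⟨h1, h2, h3⟩ w ⟨h1', h2', h3'⟩ a b ha hb hab
  refine ⟨fun n => ?_, ?_, fun n hn => ?_⟩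
  · have := h1 n
    have := h1' n
    simp only [Finsupp.coe_add, Finsupp.coe_smul, Pi.add_apply, Pi.smul_apply, smul_eq_mul]
    positivity
  · simp only [map_add, map_smul, h2, h2']; simpa using hab
  · simp [h3 n hn, h3' n hn]

/-- A bounded sequence in an inner product space has a Cauchy sequence of convex combinations of
its tails. -/
theorem exists_tailSimplex_cauchySeq {H : Type*} [NormedAddCommGroup H] [InnerProductSpace ℝ H]
    (x : ℕ → H) (M : ℝ) (hM : ∀ n, ‖x n‖ ≤ M) :
    ∃ w : ℕ → ℕ →₀ ℝ, (∀ k, w k ∈ tailSimplex k) ∧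
      CauchySeq fun k => Finsupp.linearCombination ℝ x (w k) := by
  set L := Finsupp.linearCombination ℝ x with hL
  set S : ℕ → Set ℝ := fun k => (fun w => ‖L w‖ ^ 2) '' tailSimplex k with hS
  have bdd k : BddBelow (S k) := ⟨0, by rintro _ ⟨w, -, rfl⟩; positivity⟩
  have ne k : (S k).Nonempty := ⟨_, _, single_mem_tailSimplex k, rfl⟩
  set d : ℕ → ℝ := fun k => sInf (S k) with hd
  have dle k w (hw : w ∈ tailSimplex k) : d k ≤ ‖L w‖ ^ 2 := csInf_le (bdd k) ⟨w, hw, rfl⟩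
  have dmono : Monotone d := fun k l h =>
    csInf_le_csInf (bdd k) (ne l) (image_mono (tailSimplex_anti h))
  have dbdd k : d k ≤ M ^ 2 := by
    refine (dle k _ (single_mem_tailSimplex k)).trans ?_
    have : L (Finsupp.single k 1) = x k := by simp [hL]
    rw [this]
    exact pow_le_pow_left₀ (norm_nonneg _) (hM k) 2
  have hdl : Tendsto d atTop (𝓝 (⨆ k, d k)) :=
    tendsto_atTop_ciSup dmono ⟨M ^ 2, by rintro _ ⟨k, rfl⟩; exact dbdd k⟩
  have hex k : ∃ w ∈ tailSimplex k, ‖L w‖ ^ 2 < d k + 1 / ((k : ℝ) + 1) := by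
    obtain ⟨_, ⟨w, hw, rfl⟩, h⟩ := exists_lt_of_csInf_lt (ne k)
      (show sInf (S k) < d k + 1 / ((k : ℝ) + 1) from lt_add_of_pos_right _ (by positivity))
    exact ⟨w, hw, h⟩
  choose w hw hlt using hex
  refine ⟨w, hw, ?_⟩
  set D := ⨆ k, d k with hDdef
  have hD k : d k ≤ D := le_ciSup (f := d) ⟨M ^ 2, by rintro _ ⟨k, rfl⟩; exact dbdd k⟩ k
  -- By the parallelogram law, `‖L (w k) - L (w l)‖ ^ 2` equals `2‖L (w k)‖ ^ 2 + 2‖L (w l)‖ ^ 2`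
  -- minus four times the squared norm of the midpoint. The midpoint lies over `tailSimplex k`, so
  -- its squared norm is at least `d k`, while the other two are within `1 / (k + 1)` of `d k` and
  -- `d l ≤ D`.
  set b : ℕ → ℝ := fun k => √(4 * (D - d k) + 4 * (1 / ((k : ℝ) + 1))) with hb
  refine cauchySeq_of_le_tendsto_0' b (fun k l hkl => ?_) ?_
  · rw [dist_eq_norm]
    refine Real.le_sqrt_of_sq_le ?_
    have hmid : (1 / 2 : ℝ) • w k + (1 / 2 : ℝ) • w l ∈ tailSimplex k :=
      convex_tailSimplex k (hw k) (tailSimplex_anti hkl (hw l)) (by norm_num) (by norm_num)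
        (by norm_num)
    have h1 := dle k _ hmid
    have h2 : L ((1 / 2 : ℝ) • w k + (1 / 2 : ℝ) • w l) = (1 / 2 : ℝ) • (L (w k) + L (w l)) := by
      simp [smul_add]
    rw [h2, norm_smul, mul_pow] at h1
    have h3 := parallelogram_law_with_norm ℝ (L (w k)) (L (w l))
    have h4 := hlt k
    have h5 := hlt l
    have h6 : 1 / ((l : ℝ) + 1) ≤ 1 / ((k : ℝ) + 1) := by
      have : (k : ℝ) ≤ l := by exact_mod_cast hkl
      gcongr
    have h7 := hD l
    have h8 := hD k
    norm_num at h1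
    nlinarith
  · have : Tendsto (fun k : ℕ => 4 * (D - d k) + 4 * (1 / ((k : ℝ) + 1))) atTop
        (𝓝 (4 * (D - D) + 4 * 0)) :=
      ((tendsto_const_nhds.sub hdl).const_mul 4).add
        (tendsto_one_div_add_atTop_nhds_zero_nat.const_mul 4)
    have h := (Real.continuous_sqrt.tendsto _).comp this
    simpa [hb, Function.comp_def] using h

/-! ### Convex combinations of uniformly integrable functions -/

/-- Truncation of a real number to `[-B, B]`. -/
noncomputable def truncate (B t : ℝ) : ℝ := max (-B) (min t B)

theorem measurable_truncate (B : ℝ) : Measurable (truncate B) := by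
  unfold truncate; fun_prop

theorem abs_truncate_le {B : ℝ} (hB : 0 ≤ B) (t : ℝ) : |truncate B t| ≤ B := by
  rw [abs_le, truncate]
  exact ⟨le_max_left _ _, max_le (by linarith) (min_le_right _ _)⟩

theorem enorm_sub_truncate_le {B : ℝ} (hB : 0 ≤ B) (t : ℝ) :
    ‖t - truncate B t‖ₑ ≤ {t : ℝ | B < |t|}.indicator (fun t => ‖t‖ₑ) t := by
  by_cases h : B < |t|
  · rw [indicator_of_mem (by exact h)]
    rw [enorm_le_iff_norm_le, Real.norm_eq_abs, Real.norm_eq_abs, truncate]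
    rcases le_total 0 t with ht | ht
    · rw [abs_of_nonneg ht] at h ⊢
      rw [min_eq_right h.le, max_eq_right (by linarith), abs_le]
      constructor <;> linarith
    · rw [abs_of_nonpos ht] at h ⊢
      rw [min_eq_left (by linarith), max_eq_left (by linarith), abs_le]
      constructor <;> linarith
  · rw [indicator_of_notMem (by exact h)]
    rw [not_lt, abs_le] at h
    rw [truncate, min_eq_left h.2, max_eq_right h.1]
    simp

theorem coeFn_linearCombination_toLp {Ω : Type*} [MeasurableSpace Ω] {Q : Measure Ω} {p : ℝ≥0∞}
    {f : ℕ → Ω → ℝ} (hf : ∀ n, MemLp (f n) p Q) (w : ℕ →₀ ℝ) :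
    MemLp (Finsupp.linearCombination ℝ f w) p Q ∧
    (Finsupp.linearCombination ℝ (fun n => (hf n).toLp) w : Ω → ℝ) =ᵐ[Q]
      Finsupp.linearCombination ℝ f w := by
  induction w using Finsupp.induction_linear with
  | zero => simpa using Lp.coeFn_zero ℝ p Q
  | add v w hv hw =>
    simp only [map_add]
    exact ⟨hv.1.add hw.1, (Lp.coeFn_add _ _).trans (hv.2.add hw.2)⟩
  | single n a =>
    simp only [Finsupp.linearCombination_single]
    exact ⟨(hf n).const_smul a, (Lp.coeFn_smul _ _).trans ((hf n).coeFn_toLp.const_smul a)⟩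

theorem measurable_linearCombination {Ω : Type*} [MeasurableSpace Ω] {g : ℕ → Ω → ℝ}
    (hg : ∀ n, Measurable (g n)) (v : ℕ →₀ ℝ) :
    Measurable (Finsupp.linearCombination ℝ g v) := by
  induction v using Finsupp.induction_linear with
  | zero => simpa using measurable_zero
  | add v w hv hw => simpa using hv.add hw
  | single n a => simpa using (hg n).const_smul a

theorem convex_setOf_eLpNorm_le {Ω : Type*} [MeasurableSpace Ω] {Q : Measure Ω} {p : ℝ≥0∞}
    (hp : 1 ≤ p) (C : ℝ≥0∞) :
    Convex ℝ {h : Ω → ℝ | AEStronglyMeasurable h Q ∧ eLpNorm h p Q ≤ C} := by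
  rintro g ⟨hg, hg'⟩ h ⟨hh, hh'⟩ a b ha hb hab
  refine ⟨(hg.const_smul a).add (hh.const_smul b), ?_⟩
  refine (eLpNorm_add_le (hg.const_smul a) (hh.const_smul b) hp).trans ?_
  rw [eLpNorm_const_smul, eLpNorm_const_smul]
  calc _ ≤ ‖a‖ₑ * C + ‖b‖ₑ * C := by gcongr
    _ = C := by
      rw [← add_mul, Real.enorm_of_nonneg ha, Real.enorm_of_nonneg hb,
        ← ENNReal.ofReal_add ha hb, hab]; simp

/-- Truncation bound for functions in `L²` of a finite measure: the sequence of all truncations,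
scaled so as to be square summable. -/
theorem exists_tailSimplex_truncate_cauchySeq {Ω : Type*} [MeasurableSpace Ω] (Q : Measure Ω)
    [IsFiniteMeasure Q] (f : ℕ → Ω → ℝ) (hf : ∀ n, Measurable (f n)) :
    ∃ w : ℕ → ℕ →₀ ℝ, (∀ k, w k ∈ tailSimplex k) ∧ ∀ B : ℕ, ∀ ε : ℝ≥0∞, ε ≠ 0 → ∃ N, ∀ k ≥ N, ∀ l ≥ N,
      eLpNorm (Finsupp.linearCombination ℝ (fun n => truncate B ∘ f n) (w k) -
        Finsupp.linearCombination ℝ (fun n => truncate B ∘ f n) (w l)) 2 Q ≤ ε := by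
  have hmem (B : ℕ) n : MemLp (truncate B ∘ f n) 2 Q :=
    MemLp.of_bound ((measurable_truncate B).comp (hf n)).aestronglyMeasurable B
      (ae_of_all _ fun z => abs_truncate_le (Nat.cast_nonneg B) _)
  set M : ℕ → ℝ := fun B => (Q.real univ) ^ (1 / 2 : ℝ) * B with hMdef
  have hbd (B : ℕ) n : ‖(hmem B n).toLp‖ ≤ M B := by
    have := Lp.norm_le_of_ae_bound (p := 2) (μ := Q) (f := (hmem B n).toLp) (C := B) (Nat.cast_nonneg B)
      (by filter_upwards [(hmem B n).coeFn_toLp] with z hz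
          rw [hz]; exact abs_truncate_le (Nat.cast_nonneg B) _)
    refine this.trans (le_of_eq ?_)
    simp only [hMdef]
    congr 1
    rw [ENNReal.toReal_ofNat, ← one_div]
    rfl
  set c : ℕ → ℝ := fun B => (1 / 2) ^ B / (1 + M B) with hc
  have hM0 B : 0 ≤ M B := by simp only [hMdef]; positivity
  have hc0 B : 0 < c B := by
    have := hM0 B
    simp only [hc]; positivity
  have hcb B n : ‖c B • (hmem B n).toLp‖ ≤ (1 / 2) ^ B := by
    rw [norm_smul, Real.norm_of_nonneg (hc0 B).le]
    calc c B * _ ≤ c B * M B := by gcongr; exacts [hbd B n]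
      _ ≤ c B * (1 + M B) := by gcongr; linarith
      _ = _ := by simp only [hc]; have := hM0 B; field_simp
  have hsum : Summable fun B : ℕ => ((1 / 2 : ℝ) ^ B) ^ (2 : ℝ≥0∞).toReal := by
    have : (fun B : ℕ => ((1 / 2 : ℝ) ^ B) ^ (2 : ℝ≥0∞).toReal) = fun B => (1 / 4 : ℝ) ^ B := by
      ext B; rw [ENNReal.toReal_ofNat, Real.rpow_ofNat, ← pow_mul, mul_comm, pow_mul]; norm_num
    rw [this]
    exact summable_geometric_of_lt_one (by norm_num) (by norm_num)
  have hℓ n : Memℓp (fun B => c B • (hmem B n).toLp) 2 := by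
    refine memℓp_gen (hsum.of_nonneg_of_le (fun B => by positivity) fun B => ?_)
    exact Real.rpow_le_rpow (norm_nonneg _) (hcb B n) (by simp)
  -- All truncation levels sit in a single Hilbert sum, so one sequence of weights serves every `B`
  -- and no diagonal extraction is needed.
  let x : ℕ → lp (fun _ : ℕ => Lp ℝ 2 Q) 2 := fun n => ⟨_, hℓ n⟩
  obtain ⟨w, hw, hC⟩ := exists_tailSimplex_cauchySeq x
    ((∑' B : ℕ, ((1 / 2 : ℝ) ^ B) ^ (2 : ℝ≥0∞).toReal) ^ (1 / (2 : ℝ≥0∞).toReal)) fun n => by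
      rw [lp.norm_eq_tsum_rpow (by simp)]
      refine Real.rpow_le_rpow (tsum_nonneg fun B => by positivity) ?_ (by simp)
      have hle B : ‖x n B‖ ^ (2 : ℝ≥0∞).toReal ≤ ((1 / 2 : ℝ) ^ B) ^ (2 : ℝ≥0∞).toReal :=
        Real.rpow_le_rpow (norm_nonneg _) (hcb B n) (by simp)
      exact (hsum.of_nonneg_of_le (fun B => by positivity) hle).tsum_le_tsum hle hsum
  refine ⟨w, hw, fun B ε hε => ?_⟩
  have happ v : (Finsupp.linearCombination ℝ x v : lp (fun _ : ℕ => Lp ℝ 2 Q) 2) B =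
      c B • Finsupp.linearCombination ℝ (fun n => (hmem B n).toLp) v := by
    induction v using Finsupp.induction_linear with
    | zero => simp
    | add v w hv hw => simp only [map_add, lp.coeFn_add, Pi.add_apply, hv, hw, smul_add]
    | single n a => simp [x, smul_comm (c B) a]
  obtain ⟨δ, hδ0, hδ⟩ : ∃ δ : ℝ, 0 < δ ∧ ENNReal.ofReal δ ≤ ε := by
    rcases eq_or_ne ε ∞ with rfl | h
    · exact ⟨1, one_pos, le_top⟩
    · exact ⟨ε.toReal, ENNReal.toReal_pos hε h, ENNReal.ofReal_toReal_le⟩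
  obtain ⟨N, hN⟩ := Metric.cauchySeq_iff.1 hC (c B * δ) (by have := hc0 B; positivity)
  refine ⟨N, fun k hk l hl => ?_⟩
  have h := (hN k hk l hl).le
  rw [dist_eq_norm] at h
  have h1 := (lp.norm_apply_le_norm (by simp) _ B).trans h
  rw [← map_sub, happ, norm_smul, Real.norm_of_nonneg (hc0 B).le, mul_le_mul_iff_right₀ (hc0 B)] at h1
  have hae := (coeFn_linearCombination_toLp (hmem B) (w k - w l))
  rw [← map_sub, ← eLpNorm_congr_ae hae.2]
  rw [Lp.norm_def] at h1
  refine le_trans ?_ hδ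
  rwa [ENNReal.le_ofReal_iff_toReal_le (Lp.eLpNorm_ne_top _) hδ0.le]

/-- A uniformly integrable sequence on a finite measure space has convex combinations of its tails
that converge in `L¹`. -/
theorem exists_tailSimplex_tendsto_L1 {Ω : Type*} [MeasurableSpace Ω] (Q : Measure Ω)
    [IsFiniteMeasure Q] (f : ℕ → Ω → ℝ) (hf : ∀ n, Measurable (f n))
    (hUI : ∀ ε : ℝ≥0∞, ε ≠ 0 → ∃ B : ℝ, ∀ n, ∫⁻ z in {z | B < |f n z|}, ‖f n z‖ₑ ∂Q ≤ ε) :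
    ∃ w : ℕ → ℕ →₀ ℝ, (∀ k, w k ∈ tailSimplex k) ∧ ∃ g : Ω → ℝ, Measurable g ∧
      Tendsto (fun k => eLpNorm (Finsupp.linearCombination ℝ f (w k) - g) 1 Q) atTop (𝓝 0) := by
  obtain ⟨w, hw, hC⟩ := exists_tailSimplex_truncate_cauchySeq Q f hf
  have hUI' : ∀ ε : ℝ≥0∞, ε ≠ 0 → ∃ B : ℕ, ∀ n, eLpNorm (f n - truncate B ∘ f n) 1 Q ≤ ε := by
    intro ε hε
    obtain ⟨B, hB⟩ := hUI ε hε
    refine ⟨⌈B⌉₊, fun n => le_trans ?_ (hB n)⟩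
    have hms : MeasurableSet {z | B < |f n z|} := measurableSet_lt measurable_const (hf n).abs
    rw [eLpNorm_one_eq_lintegral_enorm, ← lintegral_indicator hms]
    refine lintegral_mono fun z => (enorm_sub_truncate_le (Nat.cast_nonneg _) (f n z)).trans ?_
    refine indicator_le_indicator_of_subset (s := {z | (⌈B⌉₊ : ℝ) < |f n z|})
      (t := {z | B < |f n z|}) (f := fun z => ‖f n z‖ₑ) (fun z hz => ?_) (by simp) z
    exact (Nat.le_ceil B).trans_lt hz
  have hfL n : MemLp (f n) 1 Q := by
    obtain ⟨B, hB⟩ := hUI' 1 one_ne_zero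
    have h1 : MemLp (f n - truncate B ∘ f n) 1 Q :=
      ⟨((hf n).sub ((measurable_truncate B).comp (hf n))).aestronglyMeasurable,
        (hB n).trans_lt ENNReal.one_lt_top⟩
    have h2 : MemLp (truncate B ∘ f n) 1 Q :=
      MemLp.of_bound ((measurable_truncate B).comp (hf n)).aestronglyMeasurable B
        (ae_of_all _ fun z => abs_truncate_le (Nat.cast_nonneg B) _)
    simpa using h1.add h2
  -- A truncation error of at most `ε / 3` for each `f n` persists under convex combinations. The
  -- remaining third compares truncated combinations, Cauchy in `L²`; `q` is the Hölder constant for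
  -- passing to `L¹` on a finite measure.
  have key : ∀ ε : ℝ≥0∞, ε ≠ 0 → ∃ N, ∀ k ≥ N, ∀ l ≥ N,
      eLpNorm (Finsupp.linearCombination ℝ f (w k) - Finsupp.linearCombination ℝ f (w l)) 1 Q
        ≤ ε := by
    intro ε hε
    have hε3 : ε / 3 ≠ 0 := by simp [hε]
    obtain ⟨B, hB⟩ := hUI' (ε / 3) hε3
    set q : ℝ≥0∞ := Q univ ^ (1 / (1 : ℝ≥0∞).toReal - 1 / (2 : ℝ≥0∞).toReal)
    have hq : q ≠ ∞ := ENNReal.rpow_ne_top_of_nonneg (by norm_num) (measure_ne_top _ _)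
    obtain ⟨N, hN⟩ := hC B (ε / 3 / (q + 1)) (by simp [hε, hq])
    refine ⟨N, fun k hk l hl => ?_⟩
    have htr v (k : ℕ) (hv : v ∈ tailSimplex k) : eLpNorm (Finsupp.linearCombination ℝ f v -
        Finsupp.linearCombination ℝ (fun n => truncate B ∘ f n) v) 1 Q ≤ ε / 3 := by
      have : Finsupp.linearCombination ℝ f v -
        Finsupp.linearCombination ℝ (fun n => truncate B ∘ f n) v =
          Finsupp.linearCombination ℝ (fun n => f n - truncate B ∘ f n) v := by
        simp [Finsupp.linearCombination_apply, Finsupp.sum, smul_sub]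
      rw [this]
      exact (linearCombination_mem_of_convex (convex_setOf_eLpNorm_le le_rfl _) (x := fun n => f n - truncate B ∘ f n)
        (fun n _ => ⟨((hf n).sub ((measurable_truncate B).comp (hf n))).aestronglyMeasurable,
          hB n⟩) hv).2
    set a := Finsupp.linearCombination ℝ f (w k)
    set b := Finsupp.linearCombination ℝ f (w l)
    have hmt n : Measurable (truncate B ∘ f n) := (measurable_truncate B).comp (hf n)
    have ma : Measurable a := measurable_linearCombination hf _
    have mb : Measurable b := measurable_linearCombination hf _
    have ma' := measurable_linearCombination hmt (w k)
    have mb' := measurable_linearCombination hmt (w l)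
    have h1 := htr (w k) k (hw k)
    have h2 := htr (w l) l (hw l)
    have h3 := hN k hk l hl
    set a' := Finsupp.linearCombination ℝ (fun n => truncate B ∘ f n) (w k)
    set b' := Finsupp.linearCombination ℝ (fun n => truncate B ∘ f n) (w l)
    have h4 : eLpNorm (a' - b') 1 Q ≤ ε / 3 := by
      refine (eLpNorm_le_eLpNorm_mul_rpow_measure_univ (p := 1) (q := 2) (by norm_num)
        (ma'.sub mb').aestronglyMeasurable).trans ?_
      calc _ ≤ ε / 3 / (q + 1) * (q + 1) := by gcongr; exact le_self_add
        _ ≤ _ := by rw [mul_comm]; exact ENNReal.mul_div_le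
    have h5 : a - b = (a - a') + ((a' - b') + (b' - b)) := by abel
    rw [h5]
    refine (eLpNorm_add_le (ma.sub ma').aestronglyMeasurable
      ((ma'.sub mb').add (mb'.sub mb)).aestronglyMeasurable le_rfl).trans ?_
    calc _ ≤ ε / 3 + (ε / 3 + ε / 3) := by
          gcongr
          refine (eLpNorm_add_le (ma'.sub mb').aestronglyMeasurable
            (mb'.sub mb).aestronglyMeasurable le_rfl).trans ?_
          gcongr
          rwa [eLpNorm_sub_comm]
      _ = ε := by rw [← add_assoc, ENNReal.add_thirds]
  have hL v := (coeFn_linearCombination_toLp hfL v)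
  have hcs : CauchySeq fun k => (hL (w k)).1.toLp := by
    rw [EMetric.cauchySeq_iff]
    intro ε hε
    obtain ⟨δ, hδ0, hδ⟩ := exists_between hε
    obtain ⟨N, hN⟩ := key δ hδ0.ne'
    refine ⟨N, fun k hk l hl => lt_of_le_of_lt ?_ hδ⟩
    rw [Lp.edist_toLp_toLp]
    exact hN k hk l hl
  obtain ⟨g, hg⟩ := cauchySeq_tendsto_of_complete hcs
  refine ⟨w, hw, (Lp.stronglyMeasurable g).measurable.comp measurable_id |> fun h => ⟨g, h, ?_⟩⟩
  rw [tendsto_iff_edist_tendsto_0] at hg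
  refine hg.congr fun k => ?_
  rw [Lp.edist_def]
  exact eLpNorm_congr_ae ((hL (w k)).1.coeFn_toLp.sub (ae_eq_refl _))

/-! ### The cut norm, and limits on a fixed space -/

section CutNorm

variable {S : Type*} [MeasurableSpace S] {μ : Measure S} {F G : S × S → ℝ}

theorem enorm_setIntegral_le_cutNorm (μ : Measure S) (F : S × S → ℝ) {T U : Set S}
    (hT : MeasurableSet T) (hU : MeasurableSet U) :
    ‖∫ z in T ×ˢ U, F z ∂(μ.prod μ)‖ₑ ≤ cutNorm μ F :=
  le_iSup₂_of_le T hT (le_iSup₂_of_le U hU le_rfl)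

theorem cutNorm_le {c : ℝ≥0∞} (h : ∀ T U, MeasurableSet T → MeasurableSet U →
    ‖∫ z in T ×ˢ U, F z ∂(μ.prod μ)‖ₑ ≤ c) : cutNorm μ F ≤ c :=
  iSup₂_le fun T hT => iSup₂_le fun U hU => h T U hT hU

theorem cutNorm_congr_ae (h : F =ᵐ[μ.prod μ] G) : cutNorm μ F = cutNorm μ G := by
  refine iSup_congr fun T => iSup_congr fun _ => iSup_congr fun U => iSup_congr fun _ => ?_
  rw [integral_congr_ae (ae_restrict_of_ae h)]

theorem cutNorm_add_le (hF : Integrable F (μ.prod μ)) (hG : Integrable G (μ.prod μ)) :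
    cutNorm μ (F + G) ≤ cutNorm μ F + cutNorm μ G := by
  refine cutNorm_le fun T U hT hU => ?_
  rw [integral_add' hF.integrableOn hG.integrableOn]
  exact (enorm_add_le _ _).trans (add_le_add (enorm_setIntegral_le_cutNorm μ F hT hU)
    (enorm_setIntegral_le_cutNorm μ G hT hU))

theorem cutNorm_sub_comm (F G : S × S → ℝ) : cutNorm μ (F - G) = cutNorm μ (G - F) := by
  refine iSup_congr fun T => iSup_congr fun _ => iSup_congr fun U => iSup_congr fun _ => ?_
  rw [← neg_sub, integral_neg', enorm_neg]

end CutNorm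

/-- This serves to replace a σ-finite measure by an equivalent finite one. The bound by `1` keeps
the new measure below the old one, and keeps the density finite and hence invertible. -/
theorem ENNReal.exists_min_one_density {Z : Type*} [MeasurableSpace Z] (Γ : Measure Z)
    [SigmaFinite Γ] : ∃ ρ : Z → ℝ≥0∞, Measurable ρ ∧ (∀ x, ρ x ≠ 0) ∧ (∀ x, ρ x ≤ 1) ∧
      ∫⁻ x, ρ x ∂Γ < ∞ := by
  obtain ⟨r, hr0, hrm, hr⟩ := exists_pos_lintegral_lt_of_sigmaFinite Γ one_ne_zero
  refine ⟨fun x => min (r x) 1, by fun_prop, fun x => ?_, fun x => min_le_right _ _, ?_⟩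
  · have := hr0 x
    simp [min_eq_iff, this.ne']
  · exact (lintegral_mono fun x => min_le_left _ _).trans_lt (hr.trans ENNReal.one_lt_top)

/-- A sequence of symmetric kernels that is Cauchy in the cut norm, semiuniformly integrable and
bounded in `L¹` converges in the cut norm; the limit inherits sign and `L^p` bounds. -/
theorem exists_cutNorm_limit {Z : Type*} [MeasurableSpace Z] (Γ : Measure Z) [SigmaFinite Γ]
    (f : ℕ → Z × Z → ℝ) (hf : ∀ n, Measurable (f n)) (hi : ∀ n, Integrable (f n) (Γ.prod Γ))
    (hs : ∀ n z, f n z.swap = f n z)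
    (hC : ∀ ε : ℝ≥0∞, ε ≠ 0 → ∃ N, ∀ m ≥ N, ∀ n ≥ N, cutNorm Γ (f m - f n) ≤ ε)
    (hUI : ∀ ε : ℝ≥0∞, ε ≠ 0 → ∃ B : ℝ, ∀ n, ∫⁻ z in {z | B < |f n z|}, ‖f n z‖ₑ ∂(Γ.prod Γ) ≤ ε)
    (K : ℝ≥0∞) (hKtop : K ≠ ∞) (hK : ∀ᶠ n in atTop, eLpNorm (f n) 1 (Γ.prod Γ) ≤ K) :
    ∃ V : Z × Z → ℝ, Measurable V ∧ (∀ z, V z.swap = V z) ∧ Integrable V (Γ.prod Γ) ∧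
      Tendsto (fun n => cutNorm Γ (f n - V)) atTop (𝓝 0) ∧
      (∀ p C : ℝ≥0∞, 1 ≤ p → (∀ n, eLpNorm (f n) p (Γ.prod Γ) ≤ C) → eLpNorm V p (Γ.prod Γ) ≤ C) ∧
      ((∀ n, ∀ᵐ z ∂(Γ.prod Γ), 0 ≤ f n z) → ∀ᵐ z ∂(Γ.prod Γ), 0 ≤ V z) := by
  obtain ⟨ρ, hρm, hρ0, hρ1, hρ⟩ := ENNReal.exists_min_one_density Γ
  set m := Γ.prod Γ with hm
  set σ : Z × Z → ℝ≥0∞ := fun z => ρ z.1 * ρ z.2 with hσ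
  have hσm : Measurable σ := by fun_prop
  -- `Q` is finite, lies below `m`, and has the same null sets: semiuniform integrability passes
  -- from `m` to `Q`, and almost everywhere statements pass back.
  set Q := m.withDensity σ with hQ
  have hQfin : IsFiniteMeasure Q := by
    refine isFiniteMeasure_withDensity (ne_of_lt ?_)
    rw [hm, lintegral_prod_mul hρm.aemeasurable hρm.aemeasurable]
    exact ENNReal.mul_lt_top hρ hρ
  have hQle : Q ≤ m := by
    calc Q ≤ m.withDensity 1 := withDensity_mono (ae_of_all _ fun z => mul_le_one' (hρ1 _) (hρ1 _))
      _ = m := withDensity_one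
  have hmQ : m ≪ Q := withDensity_absolutelyContinuous' hσm.aemeasurable
    (ae_of_all _ fun z => mul_ne_zero (hρ0 _) (hρ0 _))
  obtain ⟨w, hw, g, hg, hlim⟩ := exists_tailSimplex_tendsto_L1 Q f hf fun ε hε => by
    obtain ⟨B, hB⟩ := hUI ε hε
    exact ⟨B, fun n => (lintegral_mono' (Measure.restrict_mono le_rfl hQle) le_rfl).trans (hB n)⟩
  set h : ℕ → Z × Z → ℝ := fun k => Finsupp.linearCombination ℝ f (w k) with hh
  have hhm k : Measurable (h k) := measurable_linearCombination hf _
  have hhs k z : h k z.swap = h k z := by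
    simp only [hh, Finsupp.linearCombination_apply, Finsupp.sum, Finset.sum_apply, Pi.smul_apply,
      hs]
  obtain ⟨ns, hns, hae⟩ := (tendstoInMeasure_of_tendsto_eLpNorm one_ne_zero
    (fun k => (hhm k).aestronglyMeasurable) hg.aestronglyMeasurable hlim).exists_seq_tendsto_ae
  replace hae : ∀ᵐ z ∂m, Tendsto (fun i => h (ns i) z) atTop (𝓝 (g z)) := hmQ.ae_le hae
  -- `g` is symmetric only almost everywhere, whereas a graphon must be symmetric at every point.
  set V : Z × Z → ℝ := fun z => (g z + g z.swap) / 2 with hV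
  have hVm : Measurable V := by fun_prop
  have hVg : V =ᵐ[m] g := by
    have hsw : ∀ᵐ z ∂m, Tendsto (fun i => h (ns i) z.swap) atTop (𝓝 (g z.swap)) :=
      Measure.measurePreserving_swap.quasiMeasurePreserving.ae hae
    filter_upwards [hae, hsw] with z h1 h2
    simp only [hhs] at h2
    rw [hV]
    simp only [tendsto_nhds_unique h2 h1]
    ring
  have haeV : ∀ᵐ z ∂m, Tendsto (fun i => h (ns i) z) atTop (𝓝 (V z)) := by
    filter_upwards [hae, hVg] with z h1 h2
    rwa [h2]
  -- An `L^p` ball is convex, so it contains the combinations of late tails; Fatou then gives the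
  -- bound for their almost everywhere limit.
  have hLp (p C : ℝ≥0∞) (hp : 1 ≤ p) (hb : ∀ᶠ n in atTop, eLpNorm (f n) p m ≤ C) :
      eLpNorm V p m ≤ C := by
    obtain ⟨N, hN⟩ := eventually_atTop.1 hb
    refine Lp.eLpNorm_le_of_ae_tendsto (u := atTop) (f := fun i => h (ns i)) ?_
      (fun i => (hhm _).aestronglyMeasurable) haeV
    filter_upwards [eventually_ge_atTop N] with i hi
    exact (linearCombination_mem_of_convex (convex_setOf_eLpNorm_le hp C)
      (fun n hn => ⟨(hf n).aestronglyMeasurable, hN n (hi.trans ((hns.id_le i).trans hn))⟩)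
      (hw (ns i))).2
  have hVi : Integrable V m := memLp_one_iff_integrable.1
    ⟨hVm.aestronglyMeasurable, (hLp 1 K le_rfl hK).trans_lt hKtop.lt_top⟩
  have hgi : Integrable g m := hVi.congr hVg
  refine ⟨V, hVm, fun z => by simp [hV, add_comm], hVi, ?_, fun p C hp hb =>
    hLp p C hp (Eventually.of_forall hb), fun h0 => ?_⟩
  · rw [ENNReal.tendsto_atTop_zero]
    intro ε hε
    obtain ⟨N, hN⟩ := hC ε hε.ne'
    refine ⟨N, fun n hn => ?_⟩
    rw [cutNorm_congr_ae (G := f n - g) ((ae_eq_refl _).sub hVg)]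
    refine cutNorm_le fun T U hT hU => ?_
    -- On `A j × A j` the density `σ` is at least `1 / (j + 1) ^ 2`, so convergence in `L¹(Q)` is
    -- convergence in `L¹(m)` there. These squares exhaust `Z × Z` because `ρ` never vanishes.
    set A : ℕ → Set Z := fun j => {x | 1 / ((j : ℝ≥0∞) + 1) ≤ ρ x} with hA
    have hAm j : MeasurableSet (A j) := measurableSet_le measurable_const hρm
    have hAmono : Monotone A := fun i j hij x hx => by
      refine le_trans ?_ (show 1 / ((i : ℝ≥0∞) + 1) ≤ ρ x from hx)
      have : (i : ℝ≥0∞) ≤ j := by exact_mod_cast hij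
      gcongr
    have hAU x : ∃ j, x ∈ A j := by
      obtain ⟨j, hj⟩ := ENNReal.exists_inv_nat_lt (hρ0 x)
      refine ⟨j, le_trans ?_ hj.le⟩
      rw [one_div]
      gcongr
      exact le_self_add
    have hTm j := hT.inter (hAm j)
    have hUm j := hU.inter (hAm j)
    have hstep j : ‖∫ z in (T ∩ A j) ×ˢ (U ∩ A j), (f n - g) z ∂m‖ₑ ≤ ε := by
      set E := (T ∩ A j) ×ˢ (U ∩ A j) with hE
      have hEm : MeasurableSet E := (hTm j).prod (hUm j)
      have hconv : Convex ℝ {u : Z × Z → ℝ | Integrable u m ∧ ‖∫ z in E, (f n - u) z ∂m‖ₑ ≤ ε} := by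
        rintro u ⟨hu, hu'⟩ v ⟨hv, hv'⟩ a b ha hb hab
        refine ⟨(hu.smul a).add (hv.smul b), ?_⟩
        have : f n - (a • u + b • v) = a • (f n - u) + b • (f n - v) := by
          have : f n = a • f n + b • f n := by rw [← add_smul, hab, one_smul]
          nth_rw 1 [this]
          simp only [smul_sub]; abel
        rw [this, integral_add' (((hi n).sub hu).smul a).integrableOn
          (((hi n).sub hv).smul b).integrableOn]
        simp only [Pi.smul_apply, integral_smul]
        refine (enorm_add_le _ _).trans ?_
        rw [enorm_smul, enorm_smul]
        calc _ ≤ ‖a‖ₑ * ε + ‖b‖ₑ * ε := by gcongr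
          _ = ε := by
            rw [← add_mul, Real.enorm_of_nonneg ha, Real.enorm_of_nonneg hb,
              ← ENNReal.ofReal_add ha hb, hab]; simp
      have hk k (hk : N ≤ k) : h k ∈ {u : Z × Z → ℝ | Integrable u m ∧
          ‖∫ z in E, (f n - u) z ∂m‖ₑ ≤ ε} :=
        linearCombination_mem_of_convex hconv (fun l hl => ⟨hi l,
          (enorm_setIntegral_le_cutNorm Γ _ (hTm j) (hUm j)).trans (hN n hn l (hk.trans hl))⟩) (hw k)
      have hle (u : Z × Z → ℝ) (hu : Measurable u) :
          eLpNorm u 1 (m.restrict E) ≤ ((j : ℝ≥0∞) + 1) ^ 2 * eLpNorm u 1 Q := by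
        rw [eLpNorm_one_eq_lintegral_enorm, eLpNorm_one_eq_lintegral_enorm, hQ,
          lintegral_withDensity_eq_lintegral_mul _ hσm hu.enorm,
          ← lintegral_const_mul _ (hσm.mul hu.enorm)]
        refine le_trans (setLIntegral_mono' hEm fun z hz => ?_) (setLIntegral_le_lintegral E _)
        have hj0 : (j : ℝ≥0∞) + 1 ≠ 0 := by simp
        have hjt : (j : ℝ≥0∞) + 1 ≠ ∞ := by simp
        have h1 : 1 ≤ ((j : ℝ≥0∞) + 1) * ρ z.1 := by
          have : 1 / ((j : ℝ≥0∞) + 1) ≤ ρ z.1 := hz.1.2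
          rwa [ENNReal.div_le_iff hj0 hjt, mul_comm] at this
        have h2 : 1 ≤ ((j : ℝ≥0∞) + 1) * ρ z.2 := by
          have : 1 / ((j : ℝ≥0∞) + 1) ≤ ρ z.2 := hz.2.2
          rwa [ENNReal.div_le_iff hj0 hjt, mul_comm] at this
        calc ‖u z‖ₑ = 1 * 1 * ‖u z‖ₑ := by simp
          _ ≤ (((j : ℝ≥0∞) + 1) * ρ z.1) * (((j : ℝ≥0∞) + 1) * ρ z.2) * ‖u z‖ₑ := by gcongr
          _ = _ := by simp only [Pi.mul_apply, hσ]; ring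
      have hconvE : Tendsto (fun k => eLpNorm (h k - g) 1 (m.restrict E)) atTop (𝓝 0) := by
        refine tendsto_of_tendsto_of_tendsto_of_le_of_le tendsto_const_nhds
          (h := fun k => ((j : ℝ≥0∞) + 1) ^ 2 * eLpNorm (h k - g) 1 Q) ?_ (fun _ => zero_le)
          fun k => hle _ ((hhm k).sub hg)
        have := ENNReal.Tendsto.const_mul (a := ((j : ℝ≥0∞) + 1) ^ 2) hlim
          (Or.inr (ENNReal.pow_ne_top (by simp)))
        simpa using this
      have ht : Tendsto (fun k => ∫ z in E, (f n - h k) z ∂m) atTop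
          (𝓝 (∫ z in E, (f n - g) z ∂m)) := by
        refine tendsto_integral_of_L1' _ ((hi n).sub hgi).integrableOn.aestronglyMeasurable ?_ ?_
        · filter_upwards [eventually_ge_atTop N] with k hk'
          exact ((hi n).sub (hk k hk').1).integrableOn
        · refine hconvE.congr fun k => ?_
          rw [eLpNorm_sub_comm]
          congr 1
          abel
      refine le_of_tendsto ((continuous_enorm.tendsto _).comp ht) ?_
      filter_upwards [eventually_ge_atTop N] with k hk'
      exact (hk k hk').2
    have hU' : ⋃ j, (T ∩ A j) ×ˢ (U ∩ A j) = T ×ˢ U := by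
      ext z
      simp only [mem_iUnion, mem_prod, mem_inter_iff]
      constructor
      · rintro ⟨j, h⟩; exact ⟨h.1.1, h.2.1⟩
      · rintro ⟨h1, h2⟩
        obtain ⟨i, hi⟩ := hAU z.1
        obtain ⟨j, hj⟩ := hAU z.2
        exact ⟨max i j, ⟨h1, hAmono (le_max_left _ _) hi⟩, h2, hAmono (le_max_right _ _) hj⟩
    have ht := tendsto_setIntegral_of_monotone (μ := m) (f := f n - g)
      (s := fun j => (T ∩ A j) ×ˢ (U ∩ A j)) (fun j => (hTm j).prod (hUm j))
      (fun i j hij => prod_mono (inter_subset_inter_right _ (hAmono hij))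
        (inter_subset_inter_right _ (hAmono hij))) ((hi n).sub hgi).integrableOn
    rw [hU'] at ht
    exact le_of_tendsto ((continuous_enorm.tendsto _).comp ht) (Eventually.of_forall hstep)
  · have hall : ∀ᵐ z ∂m, ∀ n, 0 ≤ f n z := ae_all_iff.2 h0
    filter_upwards [haeV, hall] with z h1 h2
    refine ge_of_tendsto' h1 fun i => ?_
    simp only [hh, Finsupp.linearCombination_apply, Finsupp.sum, Finset.sum_apply, Pi.smul_apply,
      smul_eq_mul]
    exact Finset.sum_nonneg fun n _ => mul_nonneg ((hw _).1 n) (h2 n)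

/-! ### The cut norm under maps -/

section CutNormTransport

variable {Z Y : Type*} [MeasurableSpace Z] [MeasurableSpace Y]

theorem cutNorm_restrict_le {μ : Measure Z} [SFinite μ] {A : Set Z} (hA : MeasurableSet A)
    (F : Z × Z → ℝ) : cutNorm (μ.restrict A) F ≤ cutNorm μ F := by
  refine cutNorm_le fun T U hT hU => ?_
  rw [Measure.prod_restrict, Measure.restrict_restrict (hT.prod hU), prod_inter_prod]
  exact enorm_setIntegral_le_cutNorm μ F (hT.inter hA) (hU.inter hA)

theorem cutNorm_le_restrict {μ : Measure Z} [SFinite μ] {A : Set Z}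
    {F : Z × Z → ℝ} (hF : ∀ x y, x ∉ A ∨ y ∉ A → F (x, y) = 0) :
    cutNorm μ F ≤ cutNorm (μ.restrict A) F := by
  refine cutNorm_le fun T U hT hU => ?_
  have := enorm_setIntegral_le_cutNorm (μ.restrict A) F hT hU
  rw [Measure.prod_restrict, Measure.restrict_restrict (hT.prod hU)] at this
  convert this using 2
  refine setIntegral_eq_of_subset_of_forall_sdiff_eq_zero (hT.prod hU) inter_subset_left ?_
  rintro ⟨x, y⟩ ⟨h1, h2⟩
  refine hF x y ?_
  by_contra! h
  exact h2 ⟨h1, h⟩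

theorem cutNorm_map_le {Γ : Measure Z} [SFinite Γ] {π : Z → Y} (hπ : Measurable π)
    {F : Y × Y → ℝ} (hF : Measurable F) :
    cutNorm (Γ.map π) F ≤ cutNorm Γ (fun z => F (π z.1, π z.2)) := by
  refine cutNorm_le fun T U hT hU => ?_
  rw [Measure.map_prod_map _ _ hπ hπ, setIntegral_map (hT.prod hU) hF.aestronglyMeasurable
    (hπ.prodMap hπ).aemeasurable]
  exact enorm_setIntegral_le_cutNorm Γ (fun z => F (π z.1, π z.2)) (hπ hT) (hπ hU)

/-- Among all sets, the integral of `H ∘ π` is largest over `{0 ≤ H ∘ π}` and smallest over `{H ∘ π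
≤ 0}`, and both are preimages under `π`. -/
theorem exists_enorm_setIntegral_le_preimage {Γ : Measure Z} {π : Z → Y} (hπ : Measurable π)
    {H : Y → ℝ} (hH : Measurable H) (hi : Integrable (H ∘ π) Γ) {T : Set Z}
    (hT : MeasurableSet T) : ∃ P : Set Y, MeasurableSet P ∧
      ‖∫ z in T, H (π z) ∂Γ‖ₑ ≤ ‖∫ z in π ⁻¹' P, H (π z) ∂Γ‖ₑ := by
  rcases le_total 0 (∫ z in T, H (π z) ∂Γ) with h | h
  · refine ⟨{y | 0 ≤ H y}, measurableSet_le measurable_const hH, ?_⟩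
    have := setIntegral_le_nonneg hT (hH.comp hπ).stronglyMeasurable hi
    rw [enorm_le_iff_norm_le, Real.norm_of_nonneg h]
    exact this.trans (le_abs_self _)
  · refine ⟨{y | H y ≤ 0}, measurableSet_le hH measurable_const, ?_⟩
    have := setIntegral_nonpos_le hT (hH.comp hπ).stronglyMeasurable hi
    rw [enorm_le_iff_norm_le, Real.norm_of_nonpos h]
    exact (neg_le_neg this).trans (neg_le_abs _)

/-- The source may have many more measurable sets than the target. But with one side of the
rectangle fixed, integrating it out leaves a function of `π` on the other side, whose optimal set is
a preimage; doing this for `T` and then for `U` reduces to rectangles from the target. -/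
theorem cutNorm_comp_le {Γ : Measure Z} [SFinite Γ] {π : Z → Y} (hπ : Measurable π)
    {G : Y × Y → ℝ} (hG : Measurable G) (hi : Integrable G ((Γ.map π).prod (Γ.map π))) :
    cutNorm Γ (fun z => G (π z.1, π z.2)) ≤ cutNorm (Γ.map π) G := by
  have hi' : Integrable (fun z : Z × Z => G (π z.1, π z.2)) (Γ.prod Γ) := by
    rw [Measure.map_prod_map _ _ hπ hπ] at hi
    exact hi.comp_measurable (hπ.prodMap hπ)
  refine cutNorm_le fun T U hT hU => ?_
  have hir (A B : Set Z) : Integrable (fun z : Z × Z => G (π z.1, π z.2))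
      ((Γ.restrict A).prod (Γ.restrict B)) := by
    rw [Measure.prod_restrict]; exact hi'.integrableOn
  obtain ⟨P, hP, hTP⟩ : ∃ P, MeasurableSet P ∧ ‖∫ z in T ×ˢ U, G (π z.1, π z.2) ∂(Γ.prod Γ)‖ₑ ≤
      ‖∫ z in (π ⁻¹' P) ×ˢ U, G (π z.1, π z.2) ∂(Γ.prod Γ)‖ₑ := by
    have hH : Measurable fun y => ∫ z' in U, G (y, π z') ∂Γ :=
      (StronglyMeasurable.integral_prod_right' (f := fun q : Y × Z => G (q.1, π q.2))
        (by fun_prop : Measurable _).stronglyMeasurable).measurable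
    obtain ⟨P, hP, h⟩ := exists_enorm_setIntegral_le_preimage (Γ := Γ) hπ hH
      (by simpa [Function.comp_def] using (hir univ U).integral_prod_left) hT
    refine ⟨P, hP, ?_⟩
    rwa [setIntegral_prod _ hi'.integrableOn, setIntegral_prod _ hi'.integrableOn]
  obtain ⟨R, hR, hUR⟩ : ∃ R, MeasurableSet R ∧
      ‖∫ z in (π ⁻¹' P) ×ˢ U, G (π z.1, π z.2) ∂(Γ.prod Γ)‖ₑ ≤
      ‖∫ z in (π ⁻¹' P) ×ˢ (π ⁻¹' R), G (π z.1, π z.2) ∂(Γ.prod Γ)‖ₑ := by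
    have hH : Measurable fun y => ∫ z in π ⁻¹' P, G (π z, y) ∂Γ :=
      (StronglyMeasurable.integral_prod_right' (f := fun q : Y × Z => G (π q.2, q.1))
        (by fun_prop : Measurable _).stronglyMeasurable).measurable
    obtain ⟨R, hR, h⟩ := exists_enorm_setIntegral_le_preimage (Γ := Γ) hπ hH
      (by simpa [Function.comp_def] using (hir (π ⁻¹' P) univ).integral_prod_right) hU
    refine ⟨R, hR, ?_⟩
    rw [← Measure.prod_restrict, ← Measure.prod_restrict, integral_prod_symm _ (hir _ _),
      integral_prod_symm _ (hir _ _)]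
    exact h
  refine hTP.trans (hUR.trans ?_)
  have := enorm_setIntegral_le_cutNorm (Γ.map π) G hP hR
  rwa [Measure.map_prod_map _ _ hπ hπ, setIntegral_map (hP.prod hR) hG.aestronglyMeasurable
    (hπ.prodMap hπ).aemeasurable] at this

end CutNormTransport

/-! ### Disintegration and gluing along a tree -/

open ProbabilityTheory

/-- Disintegration of a measure with σ-finite first marginal. -/
theorem exists_markovKernel_compProd_eq {X Y : Type*} [MeasurableSpace X] [MeasurableSpace Y]
    [StandardBorelSpace Y] [Nonempty Y] (ρ : Measure (X × Y)) [SigmaFinite ρ.fst] :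
    ∃ κ : Kernel X Y, IsMarkovKernel κ ∧ ρ.fst ⊗ₘ κ = ρ := by
  obtain ⟨r, hrm, hr0, hr1, hr⟩ := ENNReal.exists_min_one_density ρ.fst
  have hrt x : r x ≠ ∞ := ((hr1 x).trans_lt ENNReal.one_lt_top).ne
  have hrm' : Measurable fun z : X × Y => r z.1 := by fun_prop
  have hinv : Measurable fun z : X × Y => (r z.1)⁻¹ := hrm'.inv
  -- The weight makes the measure finite and depends on the first coordinate alone, so removing it
  -- afterwards leaves the conditional kernel unchanged.
  set ρ' := ρ.withDensity fun z => r z.1 with hρ'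
  have hfin : IsFiniteMeasure ρ' := by
    refine isFiniteMeasure_withDensity (ne_of_lt ?_)
    rwa [Measure.fst, lintegral_map hrm measurable_fst] at hr
  have hfst : ρ'.fst = ρ.fst.withDensity r := by
    ext s hs
    rw [Measure.fst_apply hs, withDensity_apply _ hs, hρ', withDensity_apply _ (measurable_fst hs),
      Measure.fst, setLIntegral_map hs hrm measurable_fst]
  have hρeq : ρ = ρ'.withDensity fun z => (r z.1)⁻¹ :=
    (withDensity_inv_same hrm' (ae_of_all _ fun z => hr0 _) (ae_of_all _ fun z => hrt _)).symm
  obtain ⟨κ, hκM, hκ⟩ : ∃ κ : Kernel X Y, IsMarkovKernel κ ∧ ρ'.fst ⊗ₘ κ = ρ' :=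
    ⟨ρ'.condKernel, inferInstance, ρ'.disintegrate _⟩
  refine ⟨κ, hκM, ?_⟩
  refine Measure.ext_of_lintegral _ fun φ hφ => ?_
  conv_rhs => rw [hρeq]
  rw [lintegral_withDensity_eq_lintegral_mul _ hinv hφ, ← hκ,
    Measure.lintegral_compProd hφ, Measure.lintegral_compProd (hinv.mul hφ),
    hfst, lintegral_withDensity_eq_lintegral_mul _ hrm
      (Measurable.lintegral_kernel_prod_right' (hinv.mul hφ))]
  refine lintegral_congr fun x => ?_
  simp only [Pi.mul_apply]
  rw [lintegral_const_mul _ (by fun_prop), ← mul_assoc, ENNReal.mul_inv_cancel (hr0 x) (hrt x),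
    one_mul]

section Gluing

variable {X : Type u} [MeasurableSpace X]

theorem ProbabilityTheory.Kernel.ae_traj_eq [StandardBorelSpace X]
    {κ : (n : ℕ) → Kernel (Π _ : Finset.Iic n, X) X}
    [∀ n, IsMarkovKernel (κ n)] (m : ℕ) (h : Π _ : Finset.Iic m, X) :
    ∀ᵐ z ∂(Kernel.traj (X := fun _ => X) κ m h), ∀ (j : ℕ) (hj : j ∈ Finset.Iic m),
      z j = h ⟨j, hj⟩ := by
  have hm : Measurable (Preorder.frestrictLe (π := fun _ : ℕ => X) m) :=
    Preorder.measurable_frestrictLe m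
  have h1 : ∀ᵐ y ∂((Kernel.traj (X := fun _ => X) κ m h).map (Preorder.frestrictLe m)), y = h := by
    rw [Kernel.traj_map_frestrictLe_apply, Kernel.partialTraj_self, Kernel.id_apply]
    exact (ae_dirac_iff (measurableSet_singleton h)).2 rfl
  filter_upwards [ae_of_ae_map hm.aemeasurable h1] with z hz j hj
  rw [← hz]
  rfl

/-- This is the Markov property at time `n`, when the next step looks at the single earlier
coordinate `j`: the first `n + 1` coordinates followed by one step of `κ n` have the law of the
trajectory through time `n + 1`. -/
theorem ProbabilityTheory.Kernel.traj_apply_pair {κ : (n : ℕ) → Kernel (Π _ : Finset.Iic n, X) X}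
    [∀ n, IsMarkovKernel (κ n)] {m n : ℕ} (hmn : m ≤ n) (h : Π _ : Finset.Iic m, X)
    {j : ℕ} (hj : j ∈ Finset.Iic n) (κ' : Kernel X X) (hκ : ∀ y, κ n y = κ' (y ⟨j, hj⟩))
    {E : Set (X × X)} (hE : MeasurableSet E) :
    Kernel.traj (X := fun _ => X) κ m h {z | (z j, z (n + 1)) ∈ E} =
      ∫⁻ z, κ' (z j) (Prod.mk (z j) ⁻¹' E) ∂(Kernel.traj (X := fun _ => X) κ m h) := by
  set D : Set ((Π _ : Finset.Iic n, X) × X) := {q | (q.1 ⟨j, hj⟩, q.2) ∈ E} with hD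
  have hDm : MeasurableSet D := by
    have : Measurable fun q : (Π _ : Finset.Iic n, X) × X => (q.1 ⟨j, hj⟩, q.2) := by fun_prop
    exact this hE
  have h1 := congrArg (fun μ : Measure ((Π _ : Finset.Iic n, X) × X) => μ D) (Kernel.partialTraj_compProd_eq_map_traj (X := fun _ => X) (κ := κ) hmn (x₀ := h))
  beta_reduce at h1
  have hm : Measurable fun x : ℕ → X => (Preorder.frestrictLe (π := fun _ : ℕ => X) n x, x (n + 1)) :=
    (Preorder.measurable_frestrictLe n).prodMk (measurable_pi_apply _)
  rw [Measure.map_apply hm hDm, Measure.compProd_apply hDm, ← Kernel.traj_map_frestrictLe_apply,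
    MeasureTheory.lintegral_map (Kernel.measurable_kernel_prodMk_left hDm) (Preorder.measurable_frestrictLe n)] at h1
  refine h1.symm.trans (lintegral_congr fun z => ?_)
  rw [hκ]
  rfl

/-- Gluing along a tree: measures `γ m` on `X × X`, whose marginals agree off a base point `o` with
those of prescribed measures, are realised jointly on `ℕ → X`; all masses are considered off the
base point only, so that `X` with a point removed may carry infinite or unequal masses. -/
theorem exists_glued_measure [StandardBorelSpace X] (o : X) (p : ℕ → ℕ) (hp : ∀ m, p m ≤ m) (ν : ℕ → Measure X)
    [hν : ∀ n, SigmaFinite (ν n)] (γ : ℕ → Measure (X × X)) (h0 : ν 0 {o} = 0)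
    (h1 : ∀ m, ((γ m).map Prod.fst).restrict {o}ᶜ = ν (p m))
    (h2 : ∀ m, ((γ m).map Prod.snd).restrict {o}ᶜ = ν (m + 1))
    (hγ : ∀ m, γ m {(o, o)} = 0) :
    ∃ Γ : Measure (ℕ → X), SigmaFinite Γ ∧ (∀ n, (Γ.map fun z => z n).restrict {o}ᶜ = ν n) ∧
      ∀ m, (Γ.map fun z => (z (p m), z (m + 1))).restrict {(o, o)}ᶜ = γ m := by
  classical
  have : Nonempty X := ⟨o⟩
  have hom : MeasurableSet ({o} : Set X) := measurableSet_singleton o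
  have hν0 n : ν n {o} = 0 := by
    cases n with
    | zero => exact h0
    | succ n => rw [← h2 n, Measure.restrict_apply hom]; simp
  set ρ : ℕ → Measure (X × X) := fun m => (γ m).restrict (Prod.fst ⁻¹' {o}ᶜ) with hρ
  have hρfst m : (ρ m).fst = ν (p m) := by
    rw [← h1 m, Measure.restrict_map measurable_fst hom.compl]; rfl
  have hdis m : ∃ κ : Kernel X X, IsMarkovKernel κ ∧ ν (p m) ⊗ₘ κ = ρ m := by
    have : SigmaFinite (ρ m).fst := by rw [hρfst]; infer_instance
    rw [← hρfst m]
    exact exists_markovKernel_compProd_eq (ρ m)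
  choose κ' hκ'M hκ' using hdis
  -- Coordinate `n + 1` is drawn from coordinate `p n` by the conditional law of `γ n`; if the
  -- parent is at `o`, the child stays at `o`.
  set κt : ℕ → Kernel X X := fun m => Kernel.piecewise hom (Kernel.const X (Measure.dirac o)) (κ' m)
    with hκt
  have hκto m : κt m o = Measure.dirac o := by simp [hκt, Kernel.piecewise_apply]
  have hκtne m x (hx : x ≠ o) : κt m x = κ' m x := by simp [hκt, Kernel.piecewise_apply, hx]
  have hpm m : p m ∈ Finset.Iic m := Finset.mem_Iic.2 (hp m)
  set κ : (n : ℕ) → Kernel (Π _ : Finset.Iic n, X) X := fun n =>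
    (κt n).comap (fun y => y ⟨p n, hpm n⟩) (measurable_pi_apply _) with hκ
  have hκM n : IsMarkovKernel (κ n) := by
    have : IsMarkovKernel (κt n) := by simp only [hκt]; infer_instance
    simp only [hκ]; infer_instance
  have hκap n y : κ n y = κt n (y ⟨p n, hpm n⟩) := by simp [hκ]
  -- A path born at time `m` at the point `x` has been at `o` at all earlier times. `τ m` continues
  -- it by the kernels.
  set hist : (m : ℕ) → X → (Π _ : Finset.Iic m, X) := fun m x i => if (i : ℕ) = m then x else o
    with hhist
  have hhistm m : Measurable (hist m) := by
    refine measurable_pi_lambda _ fun i => ?_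
    by_cases hi : (i : ℕ) = m <;> simp [hhist, hi, measurable_id', measurable_const]
  set τ : ℕ → Kernel X (ℕ → X) := fun m =>
    (Kernel.traj (X := fun _ => X) κ m).comap (hist m) (hhistm m) with hτ
  have hτM m : IsMarkovKernel (τ m) := by simp only [hτ]; infer_instance
  have hτae m x : ∀ᵐ z ∂(τ m x), ∀ j ≤ m, z j = if j = m then x else o := by
    filter_upwards [Kernel.ae_traj_eq (κ := κ) m (hist m x)] with z hz j hj
    exact hz j (Finset.mem_Iic.2 hj)
  have hτpair m n (hmn : m ≤ n) x {E : Set (X × X)} (hE : MeasurableSet E) :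
      τ m x {z | (z (p n), z (n + 1)) ∈ E} =
        ∫⁻ z, κt n (z (p n)) (Prod.mk (z (p n)) ⁻¹' E) ∂(τ m x) :=
    Kernel.traj_apply_pair hmn _ (hpm n) (κt n) (hκap n) hE
  -- `η n` is the mass born at time `n`: all of `ν 0` initially, and later the part of `γ` whose
  -- parent is at `o`, which the kernels cannot produce. `Γ` is the superposition over all birth
  -- times.
  set η : ℕ → Measure X := fun n => Nat.casesOn n (ν 0)
    (fun m => ((γ m).restrict (Prod.fst ⁻¹' {o})).map Prod.snd) with hη
  have hη0 n : η n {o} = 0 := by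
    cases n with
    | zero => exact h0
    | succ n =>
      simp only [hη]
      rw [Measure.map_apply measurable_snd hom, Measure.restrict_apply (measurable_snd hom)]
      refine measure_mono_null ?_ (hγ n)
      rintro ⟨x, y⟩ ⟨hx, hy⟩
      simp_all
  set Γ' : ℕ → Measure (ℕ → X) := fun m => (η m).bind (τ m) with hΓ'
  have hΓ'ap m {s : Set (ℕ → X)} (hs : MeasurableSet s) : Γ' m s = ∫⁻ x, τ m x s ∂(η m) :=
    Measure.bind_apply hs (τ m).aemeasurable
  set Γ := Measure.sum Γ' with hΓ
  have hcoord (n : ℕ) {B : Set X} (hB : MeasurableSet B) : MeasurableSet {z : ℕ → X | z n ∈ B} :=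
    measurable_pi_apply n hB
  have hdiag m {B : Set X} (hB : MeasurableSet B) : Γ' m {z | z m ∈ B} = η m B := by
    rw [hΓ'ap m (hcoord m hB), ← lintegral_indicator_one hB]
    refine lintegral_congr fun x => ?_
    by_cases hx : x ∈ B
    · rw [indicator_of_mem hx, Pi.one_apply, ← prob_compl_eq_zero_iff (hcoord m hB)]
      refine measure_mono_null ?_ (hτae m x)
      intro z hz hz'
      exact hz (by simpa [hz' m le_rfl] using hx)
    · rw [indicator_of_notMem hx]
      refine measure_mono_null ?_ (hτae m x)
      intro z hz hz'
      exact hx (by simpa [hz' m le_rfl] using hz)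
  have hlt m j (hj : j < m) : ∀ᵐ z ∂(Γ' m), z j = o := by
    change Γ' m {z | z j ∈ ({o}ᶜ : Set X)} = 0
    rw [hΓ'ap m (hcoord j hom.compl)]
    refine (lintegral_congr fun x => ?_).trans lintegral_zero
    refine measure_mono_null ?_ (hτae m x)
    intro z hz hz'
    exact hz (by simpa [hj.ne] using hz' j hj.le)
  have hpairm n {E : Set (X × X)} (hE : MeasurableSet E) :
      MeasurableSet {z : ℕ → X | (z (p n), z (n + 1)) ∈ E} :=
    ((measurable_pi_apply (p n)).prodMk (measurable_pi_apply (n + 1))) hE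
  have hφm n {E : Set (X × X)} (hE : MeasurableSet E) :
      Measurable fun y => κt n y (Prod.mk y ⁻¹' E) :=
    Kernel.measurable_kernel_prodMk_left hE
  -- Paths born by time `n` contribute through the kernel, those born at `n + 1` contribute `η (n +
  -- 1)` over the parent `o`, and those born later sit at `(o, o)`, outside `E`.
  have hpair n {E : Set (X × X)} (hE : MeasurableSet E) (hoE : (o, o) ∉ E) :
      Γ {z | (z (p n), z (n + 1)) ∈ E} =
        ∫⁻ z, κt n (z (p n)) (Prod.mk (z (p n)) ⁻¹' E) ∂Γ + η (n + 1) (Prod.mk o ⁻¹' E) := by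
    have hφo : κt n o (Prod.mk o ⁻¹' E) = 0 := by
      rw [hκto, Measure.dirac_apply' _ (measurable_prodMk_left hE), indicator_of_notMem]
      exact hoE
    rw [hΓ, Measure.sum_apply _ (hpairm n hE), lintegral_sum_measure]
    have hφ' : Measurable fun z : ℕ → X => κt n (z (p n)) (Prod.mk (z (p n)) ⁻¹' E) :=
      (hφm n hE).comp (measurable_pi_apply (p n))
    have hterm m : Γ' m {z | (z (p n), z (n + 1)) ∈ E} =
        ∫⁻ z, κt n (z (p n)) (Prod.mk (z (p n)) ⁻¹' E) ∂(Γ' m) +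
          if m = n + 1 then η (n + 1) (Prod.mk o ⁻¹' E) else 0 := by
      rcases le_or_gt m n with hmn | hmn
      · rw [if_neg (by omega), add_zero, hΓ'ap m (hpairm n hE)]
        simp only [hΓ']
        rw [Measure.lintegral_bind (τ m).aemeasurable hφ'.aemeasurable]
        exact lintegral_congr fun x => hτpair m n hmn x hE
      · have hz : ∫⁻ z, κt n (z (p n)) (Prod.mk (z (p n)) ⁻¹' E) ∂(Γ' m) = 0 := by
          rw [lintegral_eq_zero_iff hφ']
          filter_upwards [hlt m (p n) ((hp n).trans_lt hmn)] with z hz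
          simp only [hz, hφo, Pi.zero_apply]
        rw [hz, zero_add]
        split_ifs with h
        · subst h
          rw [← hdiag (n + 1) (measurable_prodMk_left hE)]
          refine measure_congr ?_
          filter_upwards [hlt (n + 1) (p n) ((hp n).trans_lt hmn)] with z hz
          change ((z (p n), z (n + 1)) ∈ E) = ((o, z (n + 1)) ∈ E)
          rw [hz]
        · have h1 := hlt m (p n) ((hp n).trans_lt hmn)
          have h2 := hlt m (n + 1) (by omega)
          refine measure_mono_null ?_ (h1.and h2)
          intro z hz hz'
          exact hoE (by simpa [hz'.1, hz'.2] using hz)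
    simp only [hterm]
    rw [ENNReal.tsum_add, tsum_ite_eq]
  have hηγ n {E : Set (X × X)} (hE : MeasurableSet E) :
      η (n + 1) (Prod.mk o ⁻¹' E) = (γ n).restrict (Prod.fst ⁻¹' {o}) E := by
    simp only [hη]
    rw [Measure.map_apply measurable_snd (measurable_prodMk_left hE),
      Measure.restrict_apply (measurable_snd (measurable_prodMk_left hE)),
      Measure.restrict_apply hE]
    congr 1
    ext ⟨x, y⟩
    simp only [mem_inter_iff, mem_preimage, mem_singleton_iff]
    constructor <;> rintro ⟨h, rfl⟩ <;> exact ⟨h, rfl⟩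
  have hpairγ n (hn : (Γ.map fun z => z (p n)).restrict {o}ᶜ = ν (p n)) {E : Set (X × X)}
      (hE : MeasurableSet E) (hoE : (o, o) ∉ E) :
      Γ {z | (z (p n), z (n + 1)) ∈ E} = γ n E := by
    have hφo : κt n o (Prod.mk o ⁻¹' E) = 0 := by
      rw [hκto, Measure.dirac_apply' _ (measurable_prodMk_left hE), indicator_of_notMem]
      exact hoE
    rw [hpair n hE hoE, hηγ n hE, ← lintegral_map (μ := Γ) (hφm n hE) (measurable_pi_apply (p n)),
      ← setLIntegral_eq_of_support_subset (s := {o}ᶜ) (fun y hy => ?_), hn]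
    · have : ∫⁻ y, κt n y (Prod.mk y ⁻¹' E) ∂(ν (p n)) = ρ n E := by
        rw [← hκ' n, Measure.compProd_apply hE]
        refine lintegral_congr_ae ?_
        have : ∀ᵐ y ∂(ν (p n)), y ≠ o := by
          rw [ae_iff]; simpa using hν0 (p n)
        filter_upwards [this] with y hy
        rw [hκtne n y hy]
      rw [this, hρ]
      simp only
      rw [preimage_compl, add_comm, ← Measure.add_apply,
        Measure.restrict_add_restrict_compl (measurable_fst hom)]
    · intro hyo
      rw [mem_singleton_iff] at hyo
      subst hyo
      exact hy hφo
  -- Strong induction along the tree: the law at `n + 1` is a marginal of the pair law on the edge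
  -- from `p n ≤ n`, which is known once the law at `p n` is.
  have hmarg n : (Γ.map fun z => z n).restrict {o}ᶜ = ν n := by
    induction n using Nat.strong_induction_on with
    | _ n ih =>
      ext B hB
      rw [Measure.restrict_apply hB, Measure.map_apply (measurable_pi_apply n) (hB.inter hom.compl)]
      have hB' := hB.inter hom.compl
      cases n with
      | zero =>
        rw [hΓ, Measure.sum_apply _ (measurable_pi_apply 0 hB'), tsum_eq_single 0]
        · rw [show (fun z : ℕ → X => z 0) ⁻¹' (B ∩ {o}ᶜ) = {z | z 0 ∈ B ∩ {o}ᶜ} from rfl, hdiag 0 hB']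
          simp only [hη]
          exact measure_inter_conull (by simpa using h0)
        · intro m hm
          refine measure_mono_null ?_ (hlt m 0 (by omega))
          intro z hz hz'
          exact hz.2 hz'
      | succ n =>
        have := hpairγ n (ih _ (Nat.lt_succ_of_le (hp n))) (E := Prod.snd ⁻¹' (B ∩ {o}ᶜ))
          (measurable_snd hB') (fun h => h.2 rfl)
        rw [← h2 n, Measure.restrict_apply hB, Measure.map_apply measurable_snd hB', ← this]
        rfl
  refine ⟨Γ, ?_, hmarg, fun n => ?_⟩
  -- The path constantly at `o` is null, and any other path is off `o` at some time `n`, where the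
  -- σ-finite `ν n` supplies sets of finite measure.
  · set N : Set (ℕ → X) := {z | ∀ n, z n = o} with hN
    have hN0 : Γ N = 0 := by
      have hNm : MeasurableSet N := by
        have : N = ⋂ n, {z | z n ∈ ({o} : Set X)} := by ext z; simp [hN]
        rw [this]
        exact MeasurableSet.iInter fun n => hcoord n hom
      rw [hΓ, Measure.sum_apply _ hNm, ENNReal.tsum_eq_zero]
      intro m
      refine measure_mono_null (t := {z | z m ∈ ({o} : Set X)}) (fun z hz => hz m) ?_
      rw [hdiag m hom, hη0]
    refine Measure.sigmaFinite_of_countable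
      (S := insert N (range fun q : ℕ × ℕ => {z | z q.1 ∈ spanningSets (ν q.1) q.2 ∩ {o}ᶜ}))
      ((countable_range _).insert _) ?_ ?_
    · rintro s (rfl | ⟨⟨n, k⟩, rfl⟩)
      · rw [hN0]; exact ENNReal.zero_lt_top
      · have hS := measurableSet_spanningSets (ν n) k
        have h := congrArg (fun μ => μ (spanningSets (ν n) k)) (hmarg n)
        beta_reduce at h
        rw [Measure.restrict_apply hS, Measure.map_apply (measurable_pi_apply n)
          (hS.inter hom.compl)] at h
        exact h.trans_lt (measure_spanningSets_lt_top (ν n) k)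
    · rw [eq_univ_iff_forall]
      intro z
      by_cases hz : z ∈ N
      · exact ⟨N, mem_insert _ _, hz⟩
      · simp only [hN, mem_ofPred_eq, not_forall] at hz
        obtain ⟨n, hn⟩ := hz
        have := mem_iUnion.1 ((iUnion_spanningSets (ν n)).symm ▸ mem_univ (z n))
        obtain ⟨k, hk⟩ := this
        exact ⟨_, mem_insert_of_mem _ ⟨(n, k), rfl⟩, hk, hn⟩
  · ext E hE
    have hoo : MeasurableSet ({(o, o)} : Set (X × X)) := measurableSet_singleton _
    have hE' := hE.inter hoo.compl
    rw [Measure.restrict_apply hE, Measure.map_apply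
      ((measurable_pi_apply (p n)).prodMk (measurable_pi_apply (n + 1))) hE']
    have := hpairγ n (hmarg _) hE' (fun h => h.2 rfl)
    rw [show (fun z : ℕ → X => (z (p n), z (n + 1))) ⁻¹' (E ∩ {(o, o)}ᶜ) =
      {z | (z (p n), z (n + 1)) ∈ E ∩ {(o, o)}ᶜ} from rfl, this]
    exact measure_inter_conull (by simpa using hγ n)

end Gluing

/-! ### Coding measurable functions in the Cantor space -/

section Representation

variable {S : Type*} [MeasurableSpace S]

/-- Countably many measurable maps to the Cantor space factor through a single one. -/
theorem exists_common_refinement (φ : ℕ → S → ℕ → Bool) (hφ : ∀ n, Measurable (φ n)) :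
    ∃ Φ : S → ℕ → Bool, Measurable Φ ∧
      ∀ n, ∃ r : (ℕ → Bool) → ℕ → Bool, Measurable r ∧ φ n = r ∘ Φ := by
  refine ⟨fun x k => φ k.unpair.1 x k.unpair.2,
    measurable_pi_lambda _ fun k => (measurable_pi_apply _).comp (hφ _), fun n =>
    ⟨fun b j => b (Nat.pair n j), measurable_pi_lambda _ fun j => measurable_pi_apply _, ?_⟩⟩
  ext x j
  simp

/-- The sets with such a description contain the rectangles, coded by two bits, and form a
σ-algebra: countably many codes merge into one. -/
theorem exists_preimage_prodMap_eq {s : Set (S × S)} (hs : MeasurableSet s) :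
    ∃ φ : S → ℕ → Bool, Measurable φ ∧ ∃ t : Set ((ℕ → Bool) × (ℕ → Bool)), MeasurableSet t ∧
      s = Prod.map φ φ ⁻¹' t := by
  classical
  rw [← generateFrom_prod] at hs
  induction s, hs using MeasurableSpace.generateFrom_induction with
  | hC s hs _ =>
    obtain ⟨A, hA, B, hB, rfl⟩ := hs
    refine ⟨fun x k => if k = 0 then decide (x ∈ A) else decide (x ∈ B), ?_,
      {q | q.1 0 = true ∧ q.2 1 = true}, ?_, ?_⟩
    · refine measurable_pi_lambda _ fun k => ?_
      by_cases hk : k = 0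
      · simp only [hk, if_true]
        exact measurable_to_bool (by simpa [preimage] using hA)
      · simp only [hk, if_false]
        exact measurable_to_bool (by simpa [preimage] using hB)
    · have h1 : Measurable fun q : (ℕ → Bool) × (ℕ → Bool) => q.1 0 := by fun_prop
      have h2 : Measurable fun q : (ℕ → Bool) × (ℕ → Bool) => q.2 1 := by fun_prop
      exact (h1 (measurableSet_singleton true)).inter (h2 (measurableSet_singleton true))
    · ext ⟨x, y⟩
      simp
  | empty => exact ⟨fun _ _ => true, measurable_const, ∅, MeasurableSet.empty, rfl⟩
  | compl s _ ih =>
    obtain ⟨φ, hφ, t, ht, rfl⟩ := ih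
    exact ⟨φ, hφ, tᶜ, ht.compl, rfl⟩
  | iUnion s _ ih =>
    choose φ hφ t ht hst using ih
    obtain ⟨Φ, hΦ, hr⟩ := exists_common_refinement φ hφ
    choose r hrm hr using hr
    refine ⟨Φ, hΦ, ⋃ n, Prod.map (r n) (r n) ⁻¹' t n,
      MeasurableSet.iUnion fun n => ((hrm n).prodMap (hrm n)) (ht n), ?_⟩
    rw [preimage_iUnion]
    refine iUnion_congr fun n => ?_
    rw [hst n, hr n]
    rfl

/-- A measurable function on a square factors through a measurable map to the Cantor space. -/
theorem exists_factor_cantor {W : S × S → ℝ} (hW : Measurable W) :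
    ∃ φ : S → ℕ → Bool, Measurable φ ∧ ∃ F : (ℕ → Bool) × (ℕ → Bool) → ℝ, Measurable F ∧
      ∀ x y, W (x, y) = F (φ x, φ y) := by
  obtain ⟨q, hq⟩ := exists_surjective_nat ℚ
  have h n := exists_preimage_prodMap_eq (hW (measurableSet_Ioi (a := (q n : ℝ))))
  choose φ hφ t ht hst using h
  obtain ⟨Φ, hΦ, hr⟩ := exists_common_refinement φ hφ
  choose r hrm hr using hr
  -- The superlevel sets at rational heights all come from `Φ × Φ`, so `W` is measurable for the
  -- pulled-back σ-algebra and factors by Doob–Dynkin.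
  have hWm : Measurable[MeasurableSpace.comap (Prod.map Φ Φ) inferInstance] W := by
    rw [BorelSpace.measurable_eq (α := ℝ), Real.borel_eq_generateFrom_Ioi_rat]
    refine @measurable_generateFrom _ _ (_) _ _ fun s hs => ?_
    simp only [mem_iUnion, mem_singleton_iff] at hs
    obtain ⟨a, rfl⟩ := hs
    obtain ⟨n, rfl⟩ := hq a
    refine ⟨Prod.map (r n) (r n) ⁻¹' t n, ((hrm n).prodMap (hrm n)) (ht n), ?_⟩
    rw [hst n, hr n]
    rfl
  obtain ⟨F, hF, hWF⟩ := hWm.exists_eq_measurable_comp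
  exact ⟨Φ, hΦ, F, hF, fun x y => congrFun hWF (x, y)⟩

end Representation

/-! ### Graphons over a pointed space -/

namespace Graphon

variable {X : Type u} [MeasurableSpace X]

/-- `W` is the pullback along `φ` of a symmetric function `F` on `X × X` that vanishes when one of
the coordinates is the base point `o`, a point that `φ` avoids. -/
structure IsRepresentedBy (W : Graphon.{u}) (o : X) (φ : W.S → X) (F : X × X → ℝ) : Prop where
  measurable_map : Measurable φ
  ne_base : ∀ x, φ x ≠ o
  measurable_fun : Measurable F
  symm : ∀ x y, F (x, y) = F (y, x)
  eq_zero : ∀ x y, x = o ∨ y = o → F (x, y) = 0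
  eq_comp : ∀ x y, W.W (x, y) = F (φ x, φ y)
  sigmaFinite_map : SigmaFinite (W.μ.map φ)

/-- Three families of bits are interleaved. The first determines `W`; the second records the
spanning sets, since the image of a σ-finite measure under an arbitrary map need not be σ-finite;
the third is constantly true, so no code is the all-false base point. -/
theorem exists_isRepresentedBy (e : (ℕ → Bool) ≃ᵐ X) (W : Graphon.{u}) :
    ∃ φ F, W.IsRepresentedBy (e fun _ => false) φ F := by
  classical
  obtain ⟨φ, hφ, F, hF, hWF⟩ := exists_factor_cantor W.measurable
  set ψ : ℕ → W.S → ℕ → Bool := fun n x j =>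
    if n = 0 then φ x j else if n = 1 then decide (x ∈ spanningSets W.μ j) else true with hψ
  set Φ : W.S → ℕ → Bool := fun x k => ψ k.unpair.1 x k.unpair.2 with hΦ
  have hΦpair x n j : Φ x (Nat.pair n j) = ψ n x j := by simp [hΦ]
  have hΦm : Measurable Φ := by
    refine measurable_pi_lambda _ fun k => ?_
    simp only [hΦ, hψ]
    split_ifs
    · exact (measurable_pi_apply _).comp hφ
    · exact measurable_to_bool (by simpa [preimage] using measurableSet_spanningSets W.μ _)
    · exact measurable_const
  set r : X → ℕ → Bool := fun b j => e.symm b (Nat.pair 0 j) with hr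
  have hrm : Measurable r :=
    measurable_pi_lambda _ fun j => (measurable_pi_apply _).comp e.symm.measurable
  have hrΦ x : r (e (Φ x)) = φ x := by
    ext j
    simp only [hr, e.symm_apply_apply, hΦpair, hψ, if_true]
  set o : X := e fun _ => false with ho
  have hom : MeasurableSet ({o} : Set X) := by
    have : ({o} : Set X) = e.symm ⁻¹' {fun _ => false} := by
      ext x; simp [ho, MeasurableEquiv.symm_apply_eq]
    rw [this]
    exact e.symm.measurable (measurableSet_singleton _)
  have hne x : e (Φ x) ≠ o := by
    intro h
    have := congrFun (e.injective h) (Nat.pair 2 0)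
    rw [hΦpair] at this
    simp [hψ] at this
  set D : Set (X × X) := {q | q.1 = o ∨ q.2 = o} with hD
  have hDm : MeasurableSet D := (measurable_fst hom).union (measurable_snd hom)
  -- The factor `F` is known to be symmetric only on codes of actual points, hence the average; the
  -- value on `D` is free because codes avoid `o`.
  set F' : X × X → ℝ := D.piecewise (fun _ => 0)
    (fun q => (F (r q.1, r q.2) + F (r q.2, r q.1)) / 2) with hF'
  have hF'D q (hq : q ∈ D) : F' q = 0 := piecewise_eq_of_mem _ _ _ hq
  have hF'nD q (hq : q ∉ D) : F' q = (F (r q.1, r q.2) + F (r q.2, r q.1)) / 2 :=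
    piecewise_eq_of_notMem _ _ _ hq
  refine ⟨fun x => e (Φ x), F', ⟨e.measurable.comp hΦm, hne, ?_, fun x y => ?_, fun x y h => ?_,
    fun x y => ?_, ?_⟩⟩
  · exact Measurable.piecewise hDm measurable_const (by fun_prop)
  · by_cases h : (x, y) ∈ D
    · have h' : (y, x) ∈ D := Or.symm (show x = o ∨ y = o from h)
      rw [hF'D _ h, hF'D _ h']
    · have h' : (y, x) ∉ D := fun h' => h (Or.symm (show y = o ∨ x = o from h'))
      rw [hF'nD _ h, hF'nD _ h', add_comm]
  · exact hF'D _ h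
  · rw [hF'nD _ (by rintro (h | h); exacts [hne x h, hne y h])]
    simp only [hrΦ, ← hWF]
    rw [W.symm y x]
    ring
  · have hmap : Measurable fun x => e (Φ x) := e.measurable.comp hΦm
    have hcm j : MeasurableSet {b : X | e.symm b (Nat.pair 1 j) = true} :=
      ((measurable_pi_apply (Nat.pair 1 j)).comp e.symm.measurable) (measurableSet_singleton true)
    have hpre j : (fun x => e (Φ x)) ⁻¹' {b : X | e.symm b (Nat.pair 1 j) = true} =
        spanningSets W.μ j := by
      ext x
      simp only [mem_preimage, mem_ofPred_eq, e.symm_apply_apply, hΦpair, hψ]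
      simp
    set N : Set X := (⋃ j, {b : X | e.symm b (Nat.pair 1 j) = true})ᶜ with hN
    refine Measure.sigmaFinite_of_countable
      (S := insert N (range fun j => {b : X | e.symm b (Nat.pair 1 j) = true}))
      ((countable_range _).insert _) ?_ ?_
    · rintro s (rfl | ⟨j, rfl⟩)
      · rw [Measure.map_apply hmap (MeasurableSet.iUnion hcm).compl, preimage_compl,
          preimage_iUnion]
        simp only [hpre, iUnion_spanningSets]
        simp
      · rw [Measure.map_apply hmap (hcm j), hpre]
        exact measure_spanningSets_lt_top _ _
    · rw [sUnion_insert, sUnion_range, hN, compl_union_self]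

theorem eLpNorm_comp_prod {Y : Type*} [MeasurableSpace Y] {m : Measure Y} [SFinite m] {ψ : Y → X}
    (hψ : Measurable ψ) {G : X × X → ℝ} (hG : Measurable G) (p : ℝ≥0∞) :
    eLpNorm (fun z : Y × Y => G (ψ z.1, ψ z.2)) p (m.prod m) =
      eLpNorm G p ((m.map ψ).prod (m.map ψ)) := by
  rw [Measure.map_prod_map _ _ hψ hψ,
    eLpNorm_map_measure hG.aestronglyMeasurable (hψ.prodMap hψ).aemeasurable]
  rfl

section Transport

variable {W : Graphon.{u}} {o : X} {φ : W.S → X} {F : X × X → ℝ}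

/-- `L^p` norms are computed on any space that maps to `X` with the law of `W` off the base
point. -/
theorem IsRepresentedBy.eLpNorm_comp_eq (h : W.IsRepresentedBy o φ F)
    {Y : Type*} [MeasurableSpace Y] {m : Measure Y} [SFinite m]
    {ψ : Y → X} (hψ : Measurable ψ) (hm : (m.map ψ).restrict {o}ᶜ = W.μ.map φ) {G : X × X → ℝ}
    (hG : Measurable G) (hG0 : ∀ x y, x = o ∨ y = o → G (x, y) = 0) (p : ℝ≥0∞) :
    eLpNorm (fun z : Y × Y => G (ψ z.1, ψ z.2)) p (m.prod m) =
      eLpNorm (fun z : W.S × W.S => G (φ z.1, φ z.2)) p (W.μ.prod W.μ) := by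
  rw [eLpNorm_comp_prod hψ hG, eLpNorm_comp_prod h.measurable_map hG, ← hm, Measure.prod_restrict,
    eLpNorm_restrict_eq_of_support_subset]
  rintro ⟨x, y⟩ hxy
  constructor
  · exact fun hx => hxy (hG0 x y (Or.inl hx))
  · exact fun hy => hxy (hG0 x y (Or.inr hy))

theorem IsRepresentedBy.eLpNorm_eq (h : W.IsRepresentedBy o φ F)
    {Y : Type*} [MeasurableSpace Y] {m : Measure Y} [SFinite m]
    {ψ : Y → X} (hψ : Measurable ψ) (hm : (m.map ψ).restrict {o}ᶜ = W.μ.map φ) (p : ℝ≥0∞) :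
    eLpNorm (fun z : Y × Y => F (ψ z.1, ψ z.2)) p (m.prod m) = W.lpNorm p := by
  rw [h.eLpNorm_comp_eq hψ hm h.measurable_fun h.eq_zero, lpNorm]
  congr 1
  ext ⟨x, y⟩
  exact (h.eq_comp x y).symm

theorem IsRepresentedBy.integrable (h : W.IsRepresentedBy o φ F)
    {Y : Type*} [MeasurableSpace Y] {m : Measure Y} [SFinite m]
    {ψ : Y → X} (hψ : Measurable ψ) (hm : (m.map ψ).restrict {o}ᶜ = W.μ.map φ) :
    Integrable (fun z : Y × Y => F (ψ z.1, ψ z.2)) (m.prod m) := by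
  refine memLp_one_iff_integrable.1 ⟨?_, ?_⟩
  · exact (h.measurable_fun.comp (hψ.prodMap hψ)).aestronglyMeasurable
  · rw [h.eLpNorm_eq hψ hm]
    exact (memLp_one_iff_integrable.2 W.integrable).2

theorem IsRepresentedBy.setLIntegral_eq (h : W.IsRepresentedBy o φ F)
    {Y : Type*} [MeasurableSpace Y] {m : Measure Y} [SFinite m]
    {ψ : Y → X} (hψ : Measurable ψ) (hm : (m.map ψ).restrict {o}ᶜ = W.μ.map φ) (B : ℝ) :
    ∫⁻ z in {z | B < |F (ψ z.1, ψ z.2)|}, ‖F (ψ z.1, ψ z.2)‖ₑ ∂(m.prod m) =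
      ∫⁻ z in {z | B < |W.W z|}, ‖W.W z‖ₑ ∂(W.μ.prod W.μ) := by
  have hA : MeasurableSet {q : X × X | B < |F q|} :=
    measurableSet_lt measurable_const h.measurable_fun.abs
  have := h.eLpNorm_comp_eq hψ hm (G := {q | B < |F q|}.indicator F)
    (h.measurable_fun.indicator hA) (fun x y hxy => by
      rw [indicator_apply_eq_zero]
      exact fun _ => h.eq_zero x y hxy) 1
  rw [eLpNorm_one_eq_lintegral_enorm, eLpNorm_one_eq_lintegral_enorm] at this
  have hA' : MeasurableSet {z : Y × Y | B < |F (ψ z.1, ψ z.2)|} := (hψ.prodMap hψ) hA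
  rw [← lintegral_indicator hA',
    ← lintegral_indicator (measurableSet_lt measurable_const W.measurable.abs)]
  convert this using 2
  · ext z
    rw [enorm_indicator_eq_indicator_enorm]
    rfl
  · ext ⟨x, y⟩
    rw [enorm_indicator_eq_indicator_enorm]
    simp only [indicator, mem_ofPred_eq, h.eq_comp]

theorem IsRepresentedBy.nonneg (h : W.IsRepresentedBy o φ F)
    {Y : Type*} [MeasurableSpace Y] {m : Measure Y} [SFinite m]
    {ψ : Y → X} (hψ : Measurable ψ) (hm : (m.map ψ).restrict {o}ᶜ = W.μ.map φ)
    (h0 : W.IsNonneg) : ∀ᵐ z ∂(m.prod m), 0 ≤ F (ψ z.1, ψ z.2) := by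
  -- Nonnegativity means that the negative part has `L¹` norm zero, and norms transport.
  have hG : Measurable fun q => min (F q) 0 := h.measurable_fun.min measurable_const
  have := h.eLpNorm_comp_eq hψ hm (G := fun q => min (F q) 0) hG
    (fun x y hxy => by rw [h.eq_zero x y hxy, min_self]) 1
  have hGψ : Measurable fun z : Y × Y => min (F (ψ z.1, ψ z.2)) 0 := hG.comp (hψ.prodMap hψ)
  rw [eLpNorm_congr_ae (g := 0) (μ := W.μ.prod W.μ), eLpNorm_zero, eLpNorm_eq_zero_iff
    hGψ.aestronglyMeasurable one_ne_zero] at this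
  · filter_upwards [this] with z hz
    exact min_eq_right_iff.1 hz
  · filter_upwards [h0] with ⟨x, y⟩ hz
    rw [h.eq_comp] at hz
    exact min_eq_right hz

/-- Sending every added point to `o`, where `F` vanishes, makes an extension a pullback of the same
`F`; only the mass at `o` changes. -/
theorem IsRepresentedBy.exists_map_of_isTrivialExtension (h : W.IsRepresentedBy o φ F)
    (hom : MeasurableSet ({o} : Set X)) {V : Graphon.{u}} (hV : V.IsTrivialExtension W) :
    ∃ ψ : V.S → X, Measurable ψ ∧ (V.μ.map ψ).restrict {o}ᶜ = W.μ.map φ ∧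
      ∀ x y, V.W (x, y) = F (ψ x, ψ y) := by
  obtain ⟨ι, hι, hμ, hVW, hV0⟩ := hV
  set ψ : V.S → X := Function.extend ι φ fun _ => o with hψ
  have hψm : Measurable ψ := hι.measurable_extend h.measurable_map measurable_const
  have hψι x : ψ (ι x) = φ x := hι.injective.extend_apply _ _ _
  have hψo v (hv : v ∉ range ι) : ψ v = o := Function.extend_apply' _ _ _ hv
  refine ⟨ψ, hψm, ?_, fun x y => ?_⟩
  · ext B hB
    rw [Measure.restrict_apply hB, Measure.map_apply hψm (hB.inter hom.compl),
      Measure.map_apply h.measurable_map hB]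
    have : ψ ⁻¹' (B ∩ {o}ᶜ) = ι '' (φ ⁻¹' B) := by
      ext v
      by_cases hv : v ∈ range ι
      · obtain ⟨x, rfl⟩ := hv
        simp [hψι, hι.injective.eq_iff, h.ne_base]
      · simp only [mem_preimage, hψo v hv]
        constructor
        · exact fun h => absurd rfl h.2
        · rintro ⟨x, -, rfl⟩
          exact absurd ⟨x, rfl⟩ hv
    have hms := hι.measurableSet_image.2 (h.measurable_map hB)
    have h1 := congrArg (fun μ => μ (ι '' (φ ⁻¹' B))) hμ
    beta_reduce at h1
    rw [Measure.restrict_apply hms, inter_eq_left.2 (image_subset_range _ _),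
      Measure.map_apply hι.measurable hms, preimage_image_eq _ hι.injective] at h1
    rw [this, h1]
  · by_cases hx : x ∈ range ι
    · by_cases hy : y ∈ range ι
      · obtain ⟨x, rfl⟩ := hx
        obtain ⟨y, rfl⟩ := hy
        rw [hVW, h.eq_comp, hψι, hψι]
      · rw [hV0 x y (Or.inr hy), hψo y hy, h.eq_zero _ _ (Or.inr rfl)]
    · rw [hV0 x y (Or.inl hx), hψo x hx, h.eq_zero _ _ (Or.inl rfl)]

end Transport

/-- A near-optimal coupling of trivial extensions is pushed to `X × X`. Its mass at `(o, o)`,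
possibly infinite, affects neither marginal off `o`, and deleting it does not increase the cut norm.
-/
theorem exists_pointed_coupling {o : X} (hom : MeasurableSet ({o} : Set X)) {W₁ W₂ : Graphon.{u}}
    {φ₁ : W₁.S → X} {φ₂ : W₂.S → X} {F₁ F₂ : X × X → ℝ} (h₁ : W₁.IsRepresentedBy o φ₁ F₁)
    (h₂ : W₂.IsRepresentedBy o φ₂ F₂) {ε : ℝ≥0∞} (hε : cutDist W₁ W₂ < ε) :
    ∃ γ : Measure (X × X), γ {(o, o)} = 0 ∧
      (γ.map Prod.fst).restrict {o}ᶜ = W₁.μ.map φ₁ ∧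
      (γ.map Prod.snd).restrict {o}ᶜ = W₂.μ.map φ₂ ∧
      cutNorm γ (fun z => F₁ (z.1.1, z.2.1) - F₂ (z.1.2, z.2.2)) ≤ ε := by
  simp only [cutDist, couplingDist, iInf_lt_iff] at hε
  obtain ⟨V₁, V₂, hV₁, hV₂, -, γ, hγ, hlt⟩ := hε
  obtain ⟨ψ₁, hψ₁, hm₁, hF₁⟩ := h₁.exists_map_of_isTrivialExtension hom hV₁
  obtain ⟨ψ₂, hψ₂, hm₂, hF₂⟩ := h₂.exists_map_of_isTrivialExtension hom hV₂
  have hγσ : SigmaFinite γ := by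
    refine SigmaFinite.of_map γ measurable_fst.aemeasurable ?_
    rw [hγ.map_fst]; infer_instance
  have hΨ : Measurable (Prod.map ψ₁ ψ₂) := hψ₁.prodMap hψ₂
  have hoo : MeasurableSet ({(o, o)} : Set (X × X)) := by
    rw [← singleton_prod_singleton]; exact hom.prod hom
  have hF : Measurable fun z : (X × X) × (X × X) => F₁ (z.1.1, z.2.1) - F₂ (z.1.2, z.2.2) := by
    have := h₁.measurable_fun
    have := h₂.measurable_fun
    fun_prop
  refine ⟨(γ.map (Prod.map ψ₁ ψ₂)).restrict {(o, o)}ᶜ, ?_, ?_, ?_, ?_⟩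
  · rw [Measure.restrict_apply hoo]; simp
  · rw [← hm₁]
    ext B hB
    have hB' := hB.inter hom.compl
    rw [Measure.restrict_apply hB, Measure.map_apply measurable_fst hB',
      Measure.restrict_apply (measurable_fst hB'),
      inter_eq_left.2 (by rintro ⟨x, y⟩ h h'; cases h'; exact h.2 rfl),
      Measure.map_apply hΨ (measurable_fst hB'), Measure.restrict_apply hB,
      Measure.map_apply hψ₁ hB', ← hγ.map_fst, Measure.map_apply measurable_fst (hψ₁ hB')]
    rfl
  · rw [← hm₂]
    ext B hB
    have hB' := hB.inter hom.compl
    rw [Measure.restrict_apply hB, Measure.map_apply measurable_snd hB',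
      Measure.restrict_apply (measurable_snd hB'),
      inter_eq_left.2 (by rintro ⟨x, y⟩ h h'; cases h'; exact h.2 rfl),
      Measure.map_apply hΨ (measurable_snd hB'), Measure.restrict_apply hB,
      Measure.map_apply hψ₂ hB', ← hγ.map_snd, Measure.map_apply measurable_snd (hψ₂ hB')]
    rfl
  · refine (cutNorm_restrict_le hoo.compl _).trans ((cutNorm_map_le hΨ hF).trans ?_)
    refine le_of_eq_of_le ?_ hlt.le
    congr 1
    ext z
    rw [hF₁, hF₂]
    rfl

end Graphon

/-! ### Bounding the cut distance by a cut norm -/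

namespace Graphon

variable {X : Type u} [MeasurableSpace X]

theorem isTrivialExtension_refl (V : Graphon.{u}) : V.IsTrivialExtension V := by
  refine ⟨id, MeasurableEmbedding.id, by simp, fun _ _ => rfl, fun x y h => ?_⟩
  simp at h

/-- A measure `μ` on `S` and a measure `Γ` on `Z` with the same law off a base point `o` of a
common space can be coupled over that space once `μ` is extended by the part of `Γ` that lies
over `o`. -/
theorem exists_measure_sum_coupling [StandardBorelSpace X] {S Z : Type*} [MeasurableSpace S]
    [MeasurableSpace Z] [StandardBorelSpace Z] [Nonempty Z] (μ : Measure S) [SFinite μ]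
    (Γ : Measure Z) (o : X) {φ : S → X} (hφ : Measurable φ) {π : Z → X} (hπ : Measurable π)
    [hσ : SigmaFinite (μ.map φ)] (hm : (Γ.map π).restrict {o}ᶜ = μ.map φ) :
    ∃ l : Measure ((S ⊕ Z) × Z),
      IsCouplingMeasure l (μ.map Sum.inl + (Γ.restrict (π ⁻¹' {o})).map Sum.inr) Γ ∧
      ∀ᵐ q ∂l, Sum.elim φ (fun _ => o) q.1 = π q.2 := by
  have hom : MeasurableSet ({o} : Set X) := measurableSet_singleton o
  have hAm : MeasurableSet (π ⁻¹' {o}) := hπ hom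
  have hpair : Measurable fun z : Z => (π z, z) := hπ.prodMk measurable_id
  -- Off the fibre over `o`, the graph of `π` is disintegrated over `X`, so that a point of `S` can
  -- draw a point of `Z` with the same image. The fibre over `o` is coupled diagonally with the copy
  -- of it added to `S`.
  set ρ : Measure (X × Z) := (Γ.restrict (π ⁻¹' {o})ᶜ).map fun z => (π z, z) with hρ
  have hρfst : ρ.fst = μ.map φ := by
    rw [hρ, Measure.fst, Measure.map_map measurable_fst hpair, ← hm,
      Measure.restrict_map hπ hom.compl]
    rfl
  have hρsnd : ρ.map Prod.snd = Γ.restrict (π ⁻¹' {o})ᶜ := by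
    rw [hρ, Measure.map_map measurable_snd hpair]
    exact Measure.map_id
  have hρae : ∀ᵐ q ∂ρ, q.1 = π q.2 := by
    have hms : MeasurableSet {q : X × Z | q.1 = π q.2} :=
      measurableSet_eq_fun measurable_fst (hπ.comp measurable_snd)
    rw [hρ, ae_map_iff hpair.aemeasurable hms]
    exact ae_of_all _ fun _ => rfl
  obtain ⟨κ, hκM, hκ⟩ : ∃ κ : Kernel X Z, IsMarkovKernel κ ∧ ρ.fst ⊗ₘ κ = ρ := by
    have : SigmaFinite ρ.fst := by rwa [hρfst]
    exact exists_markovKernel_compProd_eq ρ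
  set κ' : Kernel S Z := κ.comap φ hφ with hκ'
  have hφid : Measurable fun q : S × Z => (φ q.1, q.2) :=
    (hφ.comp measurable_fst).prodMk measurable_snd
  set l₁ : Measure (S × Z) := μ ⊗ₘ κ' with hl₁
  have hl₁map : l₁.map (fun q => (φ q.1, q.2)) = ρ := by
    ext E hE
    rw [Measure.map_apply hφid hE, hl₁, Measure.compProd_apply (hφid hE), ← hκ, hρfst,
      Measure.compProd_apply hE, lintegral_map (Kernel.measurable_kernel_prodMk_left hE) hφ]
    rfl
  have hl₁fst : l₁.map Prod.fst = μ := Measure.fst_compProd μ κ'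
  have hl₁snd : l₁.map Prod.snd = Γ.restrict (π ⁻¹' {o})ᶜ := by
    rw [← hρsnd, ← hl₁map, Measure.map_map measurable_snd hφid]
    rfl
  have hl₁ae : ∀ᵐ q ∂l₁, φ q.1 = π q.2 := by
    rw [← hl₁map] at hρae
    exact ae_of_ae_map hφid.aemeasurable hρae
  have hi₁ : Measurable fun q : S × Z => ((Sum.inl q.1 : S ⊕ Z), q.2) := by fun_prop
  have hi₂ : Measurable fun z : Z => ((Sum.inr z : S ⊕ Z), z) := by fun_prop
  refine ⟨l₁.map (fun q => (Sum.inl q.1, q.2)) + (Γ.restrict (π ⁻¹' {o})).map (fun z => (Sum.inr z, z)),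
    ⟨?_, ?_⟩, ?_⟩
  · rw [Measure.map_add _ _ measurable_fst, Measure.map_map measurable_fst hi₁,
      Measure.map_map measurable_fst hi₂]
    congr 1
    rw [← hl₁fst, Measure.map_map measurable_inl measurable_fst]
    rfl
  · rw [Measure.map_add _ _ measurable_snd, Measure.map_map measurable_snd hi₁,
      Measure.map_map measurable_snd hi₂]
    change l₁.map Prod.snd + (Γ.restrict (π ⁻¹' {o})).map id = _
    rw [hl₁snd, Measure.map_id, Measure.restrict_compl_add_restrict hAm]
  · have hψm : Measurable (Sum.elim φ fun _ : Z => o) := hφ.sumElim measurable_const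
    have hms : MeasurableSet {q : (S ⊕ Z) × Z | Sum.elim φ (fun _ => o) q.1 = π q.2} :=
      measurableSet_eq_fun (hψm.comp measurable_fst) (hπ.comp measurable_snd)
    rw [ae_add_measure_iff, ae_map_iff hi₁.aemeasurable hms, ae_map_iff hi₂.aemeasurable hms]
    refine ⟨hl₁ae, ?_⟩
    filter_upwards [ae_restrict_mem hAm] with z hz
    exact Eq.symm hz

theorem sigmaFinite_map_inl_add_map_inr {S Z : Type*} [MeasurableSpace S] [MeasurableSpace Z]
    (μ : Measure S) [SigmaFinite μ] (Γ : Measure Z) [SigmaFinite Γ] :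
    SigmaFinite (μ.map Sum.inl + Γ.map Sum.inr : Measure (S ⊕ Z)) := by
  have hinl : MeasurableEmbedding (Sum.inl : S → S ⊕ Z) :=
    ⟨Sum.inl_injective, measurable_inl, fun _ hs => measurableSet_inl_image.2 hs⟩
  have hinr : MeasurableEmbedding (Sum.inr : Z → S ⊕ Z) :=
    ⟨Sum.inr_injective, measurable_inr, fun _ hs => measurableSet_inr_image.2 hs⟩
  have := hinl.sigmaFinite_map (μ := μ)
  have := hinr.sigmaFinite_map (μ := Γ)
  infer_instance

/-- A represented graphon has trivial extensions by an arbitrary further measure space. -/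
theorem IsRepresentedBy.exists_isTrivialExtension_sum {W : Graphon.{u}} {o : X} {φ : W.S → X}
    {F : X × X → ℝ} (h : W.IsRepresentedBy o φ F) (hom : MeasurableSet ({o} : Set X))
    {Z : Type u} [MeasurableSpace Z] (Γ : Measure Z) [hΓ : SigmaFinite Γ] :
    ∃ hint, IsTrivialExtension
      { S := W.S ⊕ Z
        μ := W.μ.map Sum.inl + Γ.map Sum.inr
        sigmaFinite := sigmaFinite_map_inl_add_map_inr W.μ Γ
        W := fun z => F (Sum.elim φ (fun _ => o) z.1, Sum.elim φ (fun _ => o) z.2)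
        measurable := h.measurable_fun.comp ((h.measurable_map.sumElim measurable_const).prodMap
          (h.measurable_map.sumElim measurable_const))
        symm := fun _ _ => h.symm _ _
        integrable := hint } W := by
  set ψ : W.S ⊕ Z → X := Sum.elim φ fun _ => o with hψ
  have hψm : Measurable ψ := h.measurable_map.sumElim measurable_const
  have hinl : MeasurableEmbedding (Sum.inl : W.S → W.S ⊕ Z) :=
    ⟨Sum.inl_injective, measurable_inl, fun _ hs => measurableSet_inl_image.2 hs⟩
  have hσ := sigmaFinite_map_inl_add_map_inr W.μ Γ
  have hap {E : Set (W.S ⊕ Z)} (hE : MeasurableSet E) :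
      (W.μ.map Sum.inl + Γ.map Sum.inr : Measure (W.S ⊕ Z)) E = W.μ (Sum.inl ⁻¹' E) + Γ (Sum.inr ⁻¹' E) := by
    rw [Measure.add_apply, Measure.map_apply measurable_inl hE,
      Measure.map_apply measurable_inr hE]
  have hμψ : ((W.μ.map Sum.inl + Γ.map Sum.inr).map ψ).restrict {o}ᶜ = W.μ.map φ := by
    ext B hB
    have hB' := hB.inter hom.compl
    rw [Measure.restrict_apply hB, Measure.map_apply hψm hB', hap (hψm hB'),
      Measure.map_apply h.measurable_map hB]
    have h1 : (Sum.inl ⁻¹' (ψ ⁻¹' (B ∩ {o}ᶜ)) : Set W.S) = φ ⁻¹' B := by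
      ext x; simp [hψ, h.ne_base]
    have h2 : (Sum.inr ⁻¹' (ψ ⁻¹' (B ∩ {o}ᶜ)) : Set Z) = ∅ := by
      ext x; simp [hψ]
    rw [h1, h2]; simp
  refine ⟨h.integrable hψm hμψ, Sum.inl, hinl, ?_, fun x y => (h.eq_comp x y).symm,
    fun x y hxy => h.eq_zero _ _ (hxy.imp (fun hx => ?_) fun hy => ?_)⟩
  · refine Measure.ext fun E hE => ?_
    rw [Measure.restrict_apply hE, Measure.map_apply measurable_inl hE]
    refine (hap (hE.inter measurableSet_range_inl)).trans ?_
    have h1 : (Sum.inl ⁻¹' (E ∩ range Sum.inl) : Set W.S) = Sum.inl ⁻¹' E := by ext; simp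
    have h2 : (Sum.inr ⁻¹' (E ∩ range Sum.inl) : Set Z) = ∅ := by ext; simp
    rw [h1, h2]; simp
  · rcases x with x | x
    · exact absurd ⟨x, rfl⟩ hx
    · rfl
  · rcases y with y | y
    · exact absurd ⟨y, rfl⟩ hy
    · rfl

theorem _root_.IsCouplingMeasure.measure_univ_eq {S₁ S₂ : Type*} [MeasurableSpace S₁]
    [MeasurableSpace S₂] {γ : Measure (S₁ × S₂)} {μ₁ : Measure S₁} {μ₂ : Measure S₂}
    (h : IsCouplingMeasure γ μ₁ μ₂) : μ₁ univ = μ₂ univ := by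
  rw [← h.map_fst, ← h.map_snd, Measure.map_apply measurable_fst MeasurableSet.univ,
    Measure.map_apply measurable_snd MeasurableSet.univ]
  rfl

/-- The cut distance from a graphon to one that lives on a space mapping to its representing space
is bounded by the cut norm on that space. -/
theorem IsRepresentedBy.cutDist_le [StandardBorelSpace X] {W : Graphon.{u}} {o : X} {φ : W.S → X}
    {F : X × X → ℝ} (h : W.IsRepresentedBy o φ F) (V : Graphon.{u}) [StandardBorelSpace V.S]
    [Nonempty V.S] {π : V.S → X} (hπ : Measurable π)
    (hm : (V.μ.map π).restrict {o}ᶜ = W.μ.map φ) :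
    cutDist W V ≤ cutNorm V.μ (fun z => F (π z.1, π z.2) - V.W z) := by
  have := h.sigmaFinite_map
  obtain ⟨l, hl, hlae⟩ := exists_measure_sum_coupling W.μ V.μ o h.measurable_map hπ hm
  obtain ⟨hint, hext⟩ := h.exists_isTrivialExtension_sum (measurableSet_singleton o)
    (V.μ.restrict (π ⁻¹' {o}))
  have hG : Measurable fun z : V.S × V.S => F (π z.1, π z.2) - V.W z :=
    (h.measurable_fun.comp (hπ.prodMap hπ)).sub V.measurable
  have hGi : Integrable (fun z : V.S × V.S => F (π z.1, π z.2) - V.W z) (V.μ.prod V.μ) :=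
    (h.integrable hπ hm).sub V.integrable
  have hlσ : SigmaFinite l := by
    refine SigmaFinite.of_map l measurable_snd.aemeasurable ?_
    rw [hl.map_snd]; infer_instance
  refine (iInf₂_le _ V).trans ((iInf_le_of_le hext (iInf_le_of_le (isTrivialExtension_refl V)
    (iInf_le_of_le hl.measure_univ_eq (iInf₂_le l hl)))).trans ?_)
  have h1 := (Measure.quasiMeasurePreserving_fst (μ := l) (ν := l)).ae hlae
  have h2 := (Measure.quasiMeasurePreserving_snd (μ := l) (ν := l)).ae hlae
  -- Only `W` is extended. Under `l` its representing map agrees almost everywhere with `π` of the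
  -- second coordinate, so the difference is a pullback from `V.S`.
  have hle := cutNorm_comp_le (Γ := l) measurable_snd hG (by rwa [hl.map_snd])
  rw [hl.map_snd] at hle
  refine le_of_eq_of_le (cutNorm_congr_ae ?_) hle
  filter_upwards [h1, h2] with z hz1 hz2
  simp only [hz1, hz2]

end Graphon

/-! ### Moving the whole sequence to a common space -/

theorem exists_between_strictMono {N : ℕ → ℕ} (hN : StrictMono N) (h0 : N 0 = 0) (m : ℕ) :
    ∃ j, N j ≤ m ∧ m < N (j + 1) := by
  classical
  have hex : ∃ j, m < N (j + 1) := ⟨m, Nat.lt_of_succ_le (hN.id_le (m + 1))⟩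
  refine ⟨Nat.find hex, ?_, Nat.find_spec hex⟩
  rcases hj : Nat.find hex with _ | j
  · simp [h0]
  · exact not_lt.1 (Nat.find_min hex (hj ▸ Nat.lt_succ_self j))

/-- A distance that is small along the edges of a tree whose branches leave a sequence of
checkpoints `N k` is Cauchy. -/
theorem exists_forall_le_of_tree {d : ℕ → ℕ → ℝ≥0∞} (hsymm : ∀ m n, d m n = d n m)
    (htri : ∀ l m n, d l n ≤ d l m + d m n) {N : ℕ → ℕ} (hN : StrictMono N) (h0 : N 0 = 0)
    (hd : ∀ k m, N k ≤ m → m < N (k + 1) → d (N k) (m + 1) ≤ 2⁻¹ ^ k) {ε : ℝ≥0∞} (hε : ε ≠ 0) :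
    ∃ M, ∀ m ≥ M, ∀ n ≥ M, d m n ≤ ε := by
  -- Induction on the number `i` of checkpoints passed after `N k`; the bound reproduces itself
  -- because `2⁻¹ ^ k + 2 * 2⁻¹ ^ (k + 1) = 2 * 2⁻¹ ^ k`.
  have claim i : ∀ k m, N (k + i) ≤ m → m < N (k + i + 1) → d (N k) (m + 1) ≤ 2 * 2⁻¹ ^ k := by
    induction i with
    | zero =>
      intro k m h1 h2
      refine (hd k m h1 h2).trans ?_
      rw [two_mul]; exact le_self_add
    | succ i ih =>
      intro k m h1 h2
      have hk : N k < N (k + 1) := hN (Nat.lt_succ_self k)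
      -- The next checkpoint is the child with `m + 1 = N (k + 1)`, so its parent is still `N k`.
      have h3 := hd k (N (k + 1) - 1) (by omega) (by omega)
      rw [Nat.sub_add_cancel (by omega)] at h3
      have h4 := ih (k + 1) m (by rwa [show k + 1 + i = k + (i + 1) by ring])
        (by rwa [show k + 1 + i + 1 = k + (i + 1) + 1 by ring])
      calc _ ≤ d (N k) (N (k + 1)) + d (N (k + 1)) (m + 1) := htri _ _ _
        _ ≤ 2⁻¹ ^ k + 2 * 2⁻¹ ^ (k + 1) := add_le_add h3 h4
        _ = 2 * 2⁻¹ ^ k := by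
          rw [pow_succ, mul_comm _ (2⁻¹ : ℝ≥0∞), ← mul_assoc,
            ENNReal.mul_inv_cancel two_ne_zero ENNReal.ofNat_ne_top, one_mul, two_mul]
  have claim' k n (hn : N k < n) : d (N k) n ≤ 2 * 2⁻¹ ^ k := by
    obtain ⟨m, rfl⟩ : ∃ m, n = m + 1 := ⟨n - 1, by omega⟩
    obtain ⟨j, hj, hj'⟩ := exists_between_strictMono hN h0 m
    have hkj : k ≤ j := Nat.lt_succ_iff.1 (hN.lt_iff_lt.1 (lt_of_le_of_lt (Nat.lt_succ_iff.1 hn) hj'))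
    obtain ⟨i, rfl⟩ := Nat.exists_eq_add_of_le hkj
    exact claim i k m hj hj'
  obtain ⟨k, hk⟩ : ∃ k : ℕ, 4 * (2⁻¹ : ℝ≥0∞) ^ k ≤ ε := by
    have h1 : Tendsto (fun k : ℕ => 4 * (2⁻¹ : ℝ≥0∞) ^ k) atTop (𝓝 0) := by
      have := ENNReal.Tendsto.const_mul (a := 4)
        (ENNReal.tendsto_pow_atTop_nhds_zero_of_lt_one (r := 2⁻¹) (by simp))
        (Or.inr ENNReal.ofNat_ne_top)
      simpa using this
    exact ((h1.eventually (gt_mem_nhds (pos_iff_ne_zero.2 hε))).exists).imp fun _ h => h.le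
  refine ⟨N k + 1, fun m hm n hn => ?_⟩
  calc d m n ≤ d m (N k) + d (N k) n := htri _ _ _
    _ ≤ 2 * 2⁻¹ ^ k + 2 * 2⁻¹ ^ k := by
      rw [hsymm m]
      exact add_le_add (claim' k m hm) (claim' k n hn)
    _ = 4 * 2⁻¹ ^ k := by ring
    _ ≤ ε := hk

namespace Graphon

theorem _root_.MeasurableEquiv.standardBorelSpace {α β : Type*} [MeasurableSpace α]
    [MeasurableSpace β] [StandardBorelSpace β] (e : α ≃ᵐ β) : StandardBorelSpace α := by
  let _ := upgradeStandardBorel β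
  let _ : TopologicalSpace α := TopologicalSpace.induced e inferInstance
  refine ⟨⟨inferInstance, ⟨?_⟩, e.toEquiv.polishSpace_induced⟩⟩
  refine e.measurableEmbedding.comap_eq.symm.trans ?_
  rw [borel_comap, ← eq_borel_upgradeStandardBorel]

/-- Represented graphons whose cut distances decay geometrically along a sequence of checkpoints
can be moved to a common space, where they form a Cauchy sequence in the cut norm. -/
theorem exists_common_space {X : Type u} [MeasurableSpace X] [StandardBorelSpace X] {o : X}
    {W : ℕ → Graphon.{u}} {φ : ∀ n, (W n).S → X} {F : ℕ → X × X → ℝ}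
    (hrep : ∀ n, (W n).IsRepresentedBy o (φ n) (F n))
    {N : ℕ → ℕ} (hN : StrictMono N) (hN0 : N 0 = 0)
    (hrate : ∀ k m n, N k ≤ m → N k ≤ n → cutDist (W m) (W n) < 2⁻¹ ^ k) :
    ∃ Γ : Measure (ℕ → X), SigmaFinite Γ ∧
      (∀ n, (Γ.map fun z => z n).restrict {o}ᶜ = (W n).μ.map (φ n)) ∧
      ∀ ε : ℝ≥0∞, ε ≠ 0 → ∃ M, ∀ m ≥ M, ∀ n ≥ M,
        cutNorm Γ ((fun z => F m (z.1 m, z.2 m)) - fun z => F n (z.1 n, z.2 n)) ≤ ε := by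
  choose idx hidx hidx' using exists_between_strictMono hN hN0
  -- The parent of `m + 1` is the last checkpoint not after `m`, so that edge costs at most `2⁻¹ ^
  -- idx m`.
  set p : ℕ → ℕ := fun m => N (idx m) with hp
  have hγ m := exists_pointed_coupling (measurableSet_singleton o) (hrep (p m)) (hrep (m + 1))
    (hrate (idx m) (p m) (m + 1) le_rfl ((hidx m).trans (Nat.le_succ m)))
  choose γ hγ0 hγ1 hγ2 hγle using hγ
  have hσ n := (hrep n).sigmaFinite_map
  obtain ⟨Γ, hΓ, hmarg, hpair⟩ := exists_glued_measure o p hidx (fun n => (W n).μ.map (φ n)) γ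
    (by rw [Measure.map_apply (hrep 0).measurable_map (measurableSet_singleton o)]
        convert measure_empty (μ := (W 0).μ)
        ext x; simpa using (hrep 0).ne_base x) hγ1 hγ2 hγ0
  have hev n : Measurable fun z : ℕ → X => z n := measurable_pi_apply n
  set f : ℕ → (ℕ → X) × (ℕ → X) → ℝ := fun n z => F n (z.1 n, z.2 n) with hf
  have hfm n : Measurable (f n) := (hrep n).measurable_fun.comp ((hev n).prodMap (hev n))
  have hfi n : Integrable (f n) (Γ.prod Γ) := (hrep n).integrable (hev n) (hmarg n)
  have hstep m : cutNorm Γ (f (p m) - f (m + 1)) ≤ 2⁻¹ ^ idx m := by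
    set π : (ℕ → X) → X × X := fun z => (z (p m), z (m + 1)) with hπ
    have hπm : Measurable π := (hev _).prodMk (hev _)
    set G : (X × X) × (X × X) → ℝ := fun z => F (p m) (z.1.1, z.2.1) - F (m + 1) (z.1.2, z.2.2)
    have hG : Measurable G := by
      have := (hrep (p m)).measurable_fun
      have := (hrep (m + 1)).measurable_fun
      fun_prop
    have hGi : Integrable G ((Γ.map π).prod (Γ.map π)) := by
      rw [Measure.map_prod_map _ _ hπm hπm, integrable_map_measure hG.aestronglyMeasurable
        (hπm.prodMap hπm).aemeasurable]
      exact (hfi (p m)).sub (hfi (m + 1))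
    refine (cutNorm_comp_le hπm hG hGi).trans ?_
    -- Gluing controls the pair law only away from `(o, o)`, but the difference vanishes when either
    -- argument is that point.
    refine (cutNorm_le_restrict (A := {(o, o)}ᶜ) fun x y hxy => ?_).trans ?_
    · simp only [mem_compl_iff, mem_singleton_iff, not_not] at hxy
      change F (p m) (x.1, y.1) - F (m + 1) (x.2, y.2) = 0
      rw [(hrep (p m)).eq_zero, (hrep (m + 1)).eq_zero, sub_zero]
      · exact hxy.imp (fun h => by rw [h]) fun h => by rw [h]
      · exact hxy.imp (fun h => by rw [h]) fun h => by rw [h]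
    · rw [hpair m]
      exact hγle m
  refine ⟨Γ, hΓ, hmarg, fun ε hε => ?_⟩
  refine exists_forall_le_of_tree (d := fun m n => cutNorm Γ (f m - f n))
    (fun m n => cutNorm_sub_comm _ _) (fun l m n => ?_) hN hN0 (fun k m h1 h2 => ?_) hε
  · have := cutNorm_add_le ((hfi l).sub (hfi m)) ((hfi m).sub (hfi n))
    rwa [sub_add_sub_cancel] at this
  · have h3 : k = idx m := by
      have h4 := hN.lt_iff_lt.1 (h1.trans_lt (hidx' m))
      have h5 := hN.lt_iff_lt.1 ((hidx m).trans_lt h2)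
      omega
    rw [h3]
    exact hstep m

/-- Nonnegative functions whose integrals over a product converge in the cut norm are bounded
in `L¹`. -/
theorem exists_eventually_eLpNorm_one_le {Z : Type*} [MeasurableSpace Z] {Γ : Measure Z}
    {f : ℕ → Z × Z → ℝ} (hfi : ∀ n, Integrable (f n) (Γ.prod Γ))
    (hf0 : ∀ n, ∀ᵐ z ∂(Γ.prod Γ), 0 ≤ f n z) {M : ℕ}
    (hM : ∀ m ≥ M, ∀ n ≥ M, cutNorm Γ (f m - f n) ≤ 1) :
    ∃ K : ℝ≥0∞, K ≠ ∞ ∧ ∀ᶠ n in atTop, eLpNorm (f n) 1 (Γ.prod Γ) ≤ K := by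
  refine ⟨1 + ‖∫ z, f M z ∂(Γ.prod Γ)‖ₑ, by simp, ?_⟩
  filter_upwards [eventually_ge_atTop M] with n hn
  have h1 : eLpNorm (f n) 1 (Γ.prod Γ) = ‖∫ z, f n z ∂(Γ.prod Γ)‖ₑ := by
    rw [eLpNorm_one_eq_lintegral_enorm, ← ofReal_integral_norm_eq_lintegral_enorm (hfi n),
      Real.enorm_of_nonneg (integral_nonneg_of_ae (hf0 n))]
    congr 1
    refine integral_congr_ae ?_
    filter_upwards [hf0 n] with z hz
    exact Real.norm_of_nonneg hz
  have h2 := (enorm_setIntegral_le_cutNorm Γ (f n - f M) MeasurableSet.univ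
    MeasurableSet.univ).trans (hM n hn M le_rfl)
  rw [univ_prod_univ, setIntegral_univ] at h2
  rw [h1]
  calc ‖∫ z, f n z ∂(Γ.prod Γ)‖ₑ
      = ‖∫ z, (f n - f M) z ∂(Γ.prod Γ) + ∫ z, f M z ∂(Γ.prod Γ)‖ₑ := by
        rw [integral_sub' (hfi n) (hfi M), sub_add_cancel]
    _ ≤ _ := (enorm_add_le _ _).trans (add_le_add h2 le_rfl)

/-- The graphon on a given space defined by a given function. -/
abbrev ofFun {Z : Type u} [MeasurableSpace Z] (Γ : Measure Z) [SigmaFinite Γ] (V : Z × Z → ℝ)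
    (hm : Measurable V) (hs : ∀ x y, V (x, y) = V (y, x)) (hi : Integrable V (Γ.prod Γ)) :
    Graphon.{u} where
  S := Z
  μ := Γ
  W := V
  measurable := hm
  symm := hs
  integrable := hi

theorem IsRepresentedBy.cutDist_ofFun_le {X : Type u} [MeasurableSpace X] [StandardBorelSpace X]
    {W : Graphon.{u}} {o : X} {φ : W.S → X} {F : X × X → ℝ} (h : W.IsRepresentedBy o φ F)
    {Z : Type u} [MeasurableSpace Z] [StandardBorelSpace Z] [Nonempty Z] {Γ : Measure Z}
    [SigmaFinite Γ] {V : Z × Z → ℝ} (hVm : Measurable V) (hs : ∀ x y, V (x, y) = V (y, x))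
    (hi : Integrable V (Γ.prod Γ)) {π : Z → X} (hπ : Measurable π)
    (hm : (Γ.map π).restrict {o}ᶜ = W.μ.map φ) :
    cutDist W (ofFun Γ V hVm hs hi) ≤ cutNorm Γ ((fun z => F (π z.1, π z.2)) - V) :=
  h.cutDist_le (ofFun Γ V hVm hs hi) hπ hm

theorem cutConverges_ofFun {X : Type u} [MeasurableSpace X] [StandardBorelSpace X] [Nonempty X]
    {o : X} {W : ℕ → Graphon.{u}} {φ : ∀ n, (W n).S → X} {F : ℕ → X × X → ℝ}
    (hrep : ∀ n, (W n).IsRepresentedBy o (φ n) (F n)) {Γ : Measure (ℕ → X)} [SigmaFinite Γ]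
    (hmarg : ∀ n, (Γ.map fun z => z n).restrict {o}ᶜ = (W n).μ.map (φ n))
    {V : (ℕ → X) × (ℕ → X) → ℝ} (hVm : Measurable V) (hs : ∀ x y, V (x, y) = V (y, x))
    (hi : Integrable V (Γ.prod Γ))
    (hlim : Tendsto (fun n => cutNorm Γ ((fun z => F n (z.1 n, z.2 n)) - V)) atTop (𝓝 0)) :
    CutConverges W (ofFun Γ V hVm hs hi) := by
  have hle n : cutDist (W n) (ofFun Γ V hVm hs hi) ≤
      cutNorm Γ ((fun z => F n (z.1 n, z.2 n)) - V) := by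
    have := (hrep n).cutDist_ofFun_le (Z := ℕ → X) (Γ := Γ) (V := V) hVm hs hi
      (π := fun z => z n) (measurable_pi_apply n) (hmarg n)
    exact this
  have h0 : Tendsto (fun _ : ℕ => (0 : ℝ≥0∞)) atTop (𝓝 0) := tendsto_const_nhds
  have hpos n : 0 ≤ cutDist (W n) (ofFun Γ V hVm hs hi) := zero_le
  unfold CutConverges
  exact tendsto_of_tendsto_of_tendsto_of_le_of_le h0 hlim hpos hle

/-! ### Existence of the limit graphon -/

/-- The alternatives in `hK` both yield an eventual `L¹` bound on the common space: the first
directly, the second from the Cauchy property tested on the full square. -/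
theorem exists_limit_of_rate (W : ℕ → Graphon.{u}) {N : ℕ → ℕ} (hN : StrictMono N) (hN0 : N 0 = 0)
    (hrate : ∀ k m n, N k ≤ m → N k ≤ n → cutDist (W m) (W n) < 2⁻¹ ^ k)
    (hUI : ∀ ε : ℝ≥0∞, ε ≠ 0 → ∃ B : ℝ, ∀ n,
      ∫⁻ z in {z | B < |(W n).W z|}, ‖(W n).W z‖ₑ ∂((W n).μ.prod (W n).μ) ≤ ε)
    (hK : (∃ K : ℝ≥0∞, K ≠ ∞ ∧ ∀ n, (W n).lpNorm 1 ≤ K) ∨ ∀ n, (W n).IsNonneg) :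
    ∃ V, CutConverges W V ∧ (∀ p C : ℝ≥0∞, 1 ≤ p → (∀ n, (W n).lpNorm p ≤ C) → V.lpNorm p ≤ C) ∧
      ((∀ n, (W n).IsNonneg) → V.IsNonneg) := by
  -- The Cantor space is lifted so that `ℕ → X` lives in the universe of the given graphons and can
  -- carry the limit.
  obtain ⟨X, _, ⟨e⟩⟩ : ∃ (X : Type u) (_ : MeasurableSpace X), Nonempty ((ℕ → Bool) ≃ᵐ X) :=
    ⟨ULift.{u} (ℕ → Bool), inferInstance, ⟨MeasurableEquiv.ulift.symm⟩⟩
  have hX : StandardBorelSpace X := e.symm.standardBorelSpace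
  have hrep n := exists_isRepresentedBy e (W n)
  generalize (e fun _ => false) = o at hrep
  choose φ F hrep using hrep
  obtain ⟨Γ, hΓ, hmarg, hC⟩ := exists_common_space hrep hN hN0 hrate
  have hev n : Measurable fun z : ℕ → X => z n := measurable_pi_apply n
  set f : ℕ → (ℕ → X) × (ℕ → X) → ℝ := fun n z => F n (z.1 n, z.2 n) with hf
  have hfm n : Measurable (f n) := (hrep n).measurable_fun.comp ((hev n).prodMap (hev n))
  have hfi n : Integrable (f n) (Γ.prod Γ) := (hrep n).integrable (hev n) (hmarg n)
  have hfL n (q : ℝ≥0∞) : eLpNorm (f n) q (Γ.prod Γ) = (W n).lpNorm q :=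
    (hrep n).eLpNorm_eq (hev n) (hmarg n) q
  have hf0 n (h : (W n).IsNonneg) : ∀ᵐ z ∂(Γ.prod Γ), 0 ≤ f n z :=
    (hrep n).nonneg (hev n) (hmarg n) h
  obtain ⟨K, hKtop, hK⟩ : ∃ K : ℝ≥0∞, K ≠ ∞ ∧ ∀ᶠ n in atTop, eLpNorm (f n) 1 (Γ.prod Γ) ≤ K := by
    rcases hK with ⟨K, hK, h⟩ | h
    · exact ⟨K, hK, Eventually.of_forall fun n => (hfL n 1).trans_le (h n)⟩
    · obtain ⟨M, hM⟩ := hC 1 one_ne_zero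
      exact exists_eventually_eLpNorm_one_le hfi (fun n => hf0 n (h n)) hM
  obtain ⟨V, hVm, hVs, hVi, hVlim, hVL, hV0⟩ := exists_cutNorm_limit Γ f hfm hfi
    (fun n z => (hrep n).symm _ _) hC (fun ε hε => by
      obtain ⟨B, hB⟩ := hUI ε hε
      exact ⟨B, fun n => ((hrep n).setLIntegral_eq (hev n) (hmarg n) B).trans_le (hB n)⟩) K hKtop hK
  refine ⟨ofFun Γ V hVm (fun x y => hVs (y, x)) hVi, ?_,
    fun q C hq h => hVL q C hq fun n => (hfL n q).trans_le (h n), fun h => hV0 fun n => hf0 n (h n)⟩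
  have : Nonempty X := ⟨o⟩
  exact cutConverges_ofFun hrep hmarg hVm (fun x y => hVs (y, x)) hVi hVlim

theorem exists_limit (W : ℕ → Graphon.{u}) (hC : IsCutCauchy W)
    (hUI : ∀ ε : ℝ≥0∞, ε ≠ 0 → ∃ B : ℝ, ∀ n,
      ∫⁻ z in {z | B < |(W n).W z|}, ‖(W n).W z‖ₑ ∂((W n).μ.prod (W n).μ) ≤ ε)
    (hK : (∃ K : ℝ≥0∞, K ≠ ∞ ∧ ∀ n, (W n).lpNorm 1 ≤ K) ∨ ∀ n, (W n).IsNonneg) :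
    ∃ V, CutConverges W V ∧ (∀ p C : ℝ≥0∞, 1 ≤ p → (∀ n, (W n).lpNorm p ≤ C) → V.lpNorm p ≤ C) ∧
      ((∀ n, (W n).IsNonneg) → V.IsNonneg) := by
  obtain ⟨N, hN, hrate⟩ := extraction_forall_of_eventually'
    (P := fun k M => ∀ m ≥ M, ∀ n ≥ M, cutDist (W m) (W n) < 2⁻¹ ^ k) fun k => by
      obtain ⟨M, hM⟩ := hC (2⁻¹ ^ k) (ENNReal.pow_pos (by simp) k)
      exact ⟨M, fun M' hM' m hm n hn => hM m (hM'.trans hm) n (hM'.trans hn)⟩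
  have hle k : N 0 ≤ N k := hN.monotone (Nat.zero_le k)
  -- Dropping the first `N 0` terms makes the first checkpoint `0`, so that every index lies in some
  -- block.
  obtain ⟨V, hV, hL, h0⟩ := exists_limit_of_rate (fun n => W (n + N 0)) (N := fun k => N k - N 0)
    (fun k l hkl => by have := hN hkl; have := hle k; dsimp only; omega) (Nat.sub_self _)
    (fun k m n hm hn => hrate k _ (Nat.sub_le_iff_le_add.1 hm) _ (Nat.sub_le_iff_le_add.1 hn))
    (fun ε hε => (hUI ε hε).imp fun B hB n => hB _)
    (hK.imp (fun ⟨K, hK, h⟩ => ⟨K, hK, fun n => h _⟩) fun h n => h _)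
  exact ⟨V, (tendsto_add_atTop_iff_nat (N 0)).1 hV, fun p C hp h => hL p C hp fun n => h _,
    fun h => h0 fun n => h _⟩

/-! ### Integrability criteria and the five statements -/

theorem IsSemiUI.exists_forall_le {A : Set Graphon.{u}} (hA : IsSemiUI A) {ε : ℝ≥0∞} (hε : ε ≠ 0) :
    ∃ B : ℝ, ∀ W ∈ A, ∫⁻ z in {z | B < |W.W z|}, ‖W.W z‖ₑ ∂(W.μ.prod W.μ) ≤ ε := by
  obtain ⟨B, hB⟩ := (hA.eventually (gt_mem_nhds (pos_iff_ne_zero.2 hε))).exists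
  exact ⟨B, fun W hW => (le_iSup₂ (f := fun (W : Graphon.{u}) (_ : W ∈ A) =>
    ∫⁻ z in {z | B < |W.W z|}, ‖W.W z‖ₑ ∂(W.μ.prod W.μ)) W hW).trans hB.le⟩

/-- A bound in `L^p` with `p > 1` gives semiuniform integrability. -/
theorem exists_forall_setLIntegral_le_of_lpNorm_le {p : ℝ≥0∞} (hp : 1 < p) (C : ℝ≥0) {ε : ℝ≥0∞}
    (hε : ε ≠ 0) : ∃ B : ℝ, ∀ W : Graphon.{u}, W.lpNorm p ≤ C →
      ∫⁻ z in {z | B < |W.W z|}, ‖W.W z‖ₑ ∂(W.μ.prod W.μ) ≤ ε := by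
  rcases eq_or_ne p ∞ with rfl | hptop
  · refine ⟨C, fun W hW => ?_⟩
    have h1 : ∀ᵐ z ∂(W.μ.prod W.μ), ‖W.W z‖ₑ ≤ C := by
      rw [lpNorm, eLpNorm_exponent_top] at hW
      filter_upwards [enorm_ae_le_eLpNormEssSup W.W (W.μ.prod W.μ)] with z hz
      exact hz.trans hW
    have h2 : (W.μ.prod W.μ) {z | (C : ℝ) < |W.W z|} = 0 := by
      refine measure_mono_null ?_ h1
      intro z hz hz'
      have : ‖W.W z‖₊ ≤ C := by exact_mod_cast hz'
      exact absurd (show |W.W z| ≤ C from this) (not_le.2 hz)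
    rw [Measure.restrict_zero_set h2, lintegral_zero_measure]
    exact zero_le
  · set q := p.toReal with hq
    have hq1 : 1 < q := by
      rw [hq, ← ENNReal.toReal_one]
      exact (ENNReal.toReal_lt_toReal ENNReal.one_ne_top hptop).2 hp
    have hp0 : p ≠ 0 := (zero_lt_one.trans hp).ne'
    -- Where `|W| > B`, one has `|W| = |W| ^ q * |W| ^ (-(q - 1)) ≤ |W| ^ q * B ^ (-(q - 1))`; this
    -- is the resulting bound on the integral.
    have hlim : Tendsto (fun B : ℝ => (C : ℝ≥0∞) ^ q * ENNReal.ofReal (B ^ (-(q - 1)))) atTop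
        (𝓝 0) := by
      have h1 := ENNReal.tendsto_ofReal (tendsto_rpow_neg_atTop (sub_pos.2 hq1))
      have h2 := ENNReal.Tendsto.const_mul (a := (C : ℝ≥0∞) ^ q) h1
        (Or.inr (ENNReal.rpow_ne_top_of_nonneg (by linarith) ENNReal.coe_ne_top))
      simpa using h2
    obtain ⟨B, hB, hB0⟩ := ((hlim.eventually (gt_mem_nhds (pos_iff_ne_zero.2 hε))).and
      (eventually_gt_atTop 0)).exists
    refine ⟨B, fun W hW => le_trans ?_ hB.le⟩
    have hint : ∫⁻ z, ‖W.W z‖ₑ ^ q ∂(W.μ.prod W.μ) ≤ (C : ℝ≥0∞) ^ q := by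
      rw [lpNorm, eLpNorm_eq_lintegral_rpow_enorm_toReal hp0 hptop] at hW
      rwa [← ENNReal.rpow_le_rpow_iff (z := 1 / q) (by positivity), ← ENNReal.rpow_mul,
        mul_one_div_cancel (by positivity), ENNReal.rpow_one]
    have hms : MeasurableSet {z | B < |W.W z|} := measurableSet_lt measurable_const W.measurable.abs
    calc ∫⁻ z in {z | B < |W.W z|}, ‖W.W z‖ₑ ∂(W.μ.prod W.μ)
        ≤ ∫⁻ z in {z | B < |W.W z|}, ‖W.W z‖ₑ ^ q * ENNReal.ofReal (B ^ (-(q - 1)))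
            ∂(W.μ.prod W.μ) := by
          refine setLIntegral_mono' hms fun z hz => ?_
          have hz' : B < |W.W z| := hz
          have hz0 : 0 < |W.W z| := hB0.trans hz'
          rw [Real.enorm_eq_ofReal_abs, ENNReal.ofReal_rpow_of_pos hz0,
            ← ENNReal.ofReal_mul (by positivity)]
          refine ENNReal.ofReal_le_ofReal ?_
          have h1 : |W.W z| ^ (-(q - 1)) ≤ B ^ (-(q - 1)) :=
            Real.rpow_le_rpow_of_nonpos hB0 hz'.le (by linarith)
          calc |W.W z| = |W.W z| ^ q * |W.W z| ^ (-(q - 1)) := by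
                rw [← Real.rpow_add hz0]; simp
            _ ≤ _ := by gcongr
      _ ≤ ∫⁻ z, ‖W.W z‖ₑ ^ q * ENNReal.ofReal (B ^ (-(q - 1))) ∂(W.μ.prod W.μ) :=
          setLIntegral_le_lintegral _ _
      _ = (∫⁻ z, ‖W.W z‖ₑ ^ q ∂(W.μ.prod W.μ)) * ENNReal.ofReal (B ^ (-(q - 1))) :=
          lintegral_mul_const _ (W.measurable.enorm.pow_const q)
      _ ≤ _ := by gcongr

/-- This makes the `[0,1]`-valued graphons a nonnegative `L^p` ball, with `p = ∞` and radius `1`. -/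
theorem isUnitValued_iff (W : Graphon.{u}) :
    W.IsUnitValued ↔ W.IsNonneg ∧ W.lpNorm ∞ ≤ (1 : ℝ≥0) := by
  constructor
  · intro h
    refine ⟨h.mono fun z hz => hz.1, ?_⟩
    refine (eLpNorm_le_of_ae_bound (C := 1) (h.mono fun z hz => ?_)).trans (by simp)
    rw [Real.norm_of_nonneg hz.1]
    exact hz.2
  · rintro ⟨h0, h1⟩
    rw [lpNorm, eLpNorm_exponent_top] at h1
    filter_upwards [h0, enorm_ae_le_eLpNormEssSup W.W (W.μ.prod W.μ)] with z hz hz'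
    have h2 : ‖W.W z‖₊ ≤ 1 := by exact_mod_cast hz'.trans h1
    have h3 : |W.W z| ≤ 1 := h2
    exact ⟨hz, (le_abs_self _).trans h3⟩

theorem isCutComplete_nonneg_lpNorm_le {p : ℝ≥0∞} (hp : 1 < p) (C : ℝ≥0) :
    IsCutComplete {W : Graphon.{u} | W.IsNonneg ∧ W.lpNorm p ≤ C} := by
  intro W hW hC
  obtain ⟨V, hV, hL, h0⟩ := exists_limit W hC (fun ε hε =>
    (exists_forall_setLIntegral_le_of_lpNorm_le hp C hε).imp fun B hB n => hB _ (hW n).2)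
    (Or.inr fun n => (hW n).1)
  exact ⟨V, ⟨h0 fun n => (hW n).1, hL p C hp.le fun n => (hW n).2⟩, hV⟩

theorem isCutComplete_lpNorm_le {p : ℝ≥0∞} (hp : 1 < p) (C C₁ : ℝ≥0) :
    IsCutComplete {W : Graphon.{u} | W.lpNorm p ≤ C ∧ W.lpNorm 1 ≤ C₁} := by
  intro W hW hC
  obtain ⟨V, hV, hL, -⟩ := exists_limit W hC (fun ε hε =>
    (exists_forall_setLIntegral_le_of_lpNorm_le hp C hε).imp fun B hB n => hB _ (hW n).1)
    (Or.inl ⟨C₁, ENNReal.coe_ne_top, fun n => (hW n).2⟩)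
  exact ⟨V, ⟨hL p C hp.le fun n => (hW n).1, hL 1 C₁ le_rfl fun n => (hW n).2⟩, hV⟩

theorem IsCutComplete.isRelativelyCutComplete {A B : Set Graphon.{u}} (hB : IsCutComplete B)
    (hAB : A ⊆ B) : IsRelativelyCutComplete A := fun W hW hC =>
  (hB W (fun n => hAB (hW n)) hC).imp fun _ h => h.2

end Graphon

theorem theorem6p6 :
    -- (i)
    (∀ A : Set Graphon.{u}, Graphon.IsUI A → Graphon.IsRelativelyCutComplete A) ∧
    -- (ii)
    (∀ A : Set Graphon.{u}, Graphon.IsSemiUI A → (∀ W ∈ A, W.IsNonneg) →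
      Graphon.IsRelativelyCutComplete A) ∧
    -- (iii)
    (∀ p : ℝ≥0∞, 1 < p →
      (∀ C : ℝ≥0, Graphon.IsCutComplete {W : Graphon.{u} | W.IsNonneg ∧ W.lpNorm p ≤ C}) ∧
      (∀ A : Set Graphon.{u}, (∀ W ∈ A, W.IsNonneg) → (∃ C : ℝ≥0, ∀ W ∈ A, W.lpNorm p ≤ C) →
        Graphon.IsRelativelyCutComplete A)) ∧
    -- (iv)
    Graphon.IsCutComplete {W : Graphon.{u} | W.IsUnitValued} ∧
    -- (v)
    (∀ p : ℝ≥0∞, 1 < p →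
      (∀ C C₁ : ℝ≥0, Graphon.IsCutComplete
        {W : Graphon.{u} | W.lpNorm p ≤ C ∧ W.lpNorm 1 ≤ C₁}) ∧
      (∀ A : Set Graphon.{u}, (∃ C₁ : ℝ≥0, ∀ W ∈ A, W.lpNorm 1 ≤ C₁) →
        (∃ C : ℝ≥0, ∀ W ∈ A, W.lpNorm p ≤ C) → Graphon.IsRelativelyCutComplete A)) := by
  refine ⟨fun A hA W hW hC => ?_, fun A hA h0 W hW hC => ?_, fun p hp => ⟨fun C => ?_, ?_⟩, ?_,
    fun p hp => ⟨fun C C₁ => ?_, ?_⟩⟩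
  · obtain ⟨V, hV, -⟩ := Graphon.exists_limit W hC (fun ε hε =>
      (hA.2.exists_forall_le hε).imp fun B hB n => hB _ (hW n))
      (Or.inl ⟨_, hA.1.ne, fun n => by
        rw [Graphon.lpNorm, eLpNorm_one_eq_lintegral_enorm]
        exact le_iSup₂ (f := fun (W : Graphon.{u}) (_ : W ∈ A) =>
          ∫⁻ z, ‖W.W z‖ₑ ∂(W.μ.prod W.μ)) (W n) (hW n)⟩)
    exact ⟨V, hV⟩
  · obtain ⟨V, hV, -⟩ := Graphon.exists_limit W hC (fun ε hε =>
      (hA.exists_forall_le hε).imp fun B hB n => hB _ (hW n)) (Or.inr fun n => h0 _ (hW n))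
    exact ⟨V, hV⟩
  · exact Graphon.isCutComplete_nonneg_lpNorm_le hp C
  · rintro A h0 ⟨C, hC⟩
    exact (Graphon.isCutComplete_nonneg_lpNorm_le hp C).isRelativelyCutComplete
      fun W hW => ⟨h0 W hW, hC W hW⟩
  · simp only [Graphon.isUnitValued_iff]
    exact Graphon.isCutComplete_nonneg_lpNorm_le ENNReal.one_lt_top 1
  · exact Graphon.isCutComplete_lpNorm_le hp C C₁
  · rintro A ⟨C₁, hC₁⟩ ⟨C, hC⟩
    exact (Graphon.isCutComplete_lpNorm_le hp C C₁).isRelativelyCutComplete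
      fun W hW => ⟨hC W hW, hC₁ W hW⟩
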